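/- **Setting.** Let $(\Omega,\mathcal B,\mathbf P)$ be a probability space, $T:\Omega\to\Omega$ an invertible (with measurable inverse) measure-preserving ergodic transformation, $\mathcal Y\subseteq\mathcal B$ a sub-$\sigma$-field, and $(U,\mathcal U)$ a nonempty measurable space. Let $\ell:U\times\Omega\to\mathbb R$ be measurable with $|\ell(u,\omega)|\le\Lambda(\omega)$ for all $u,\omega$, where $\Lambda\in L^1(\mathbf P)$. For $-\infty\le m\le n<\infty$ let $\mathcal Y_{m,n}=\bigvee_{k\in\mathbb Z,\,m\le k\le n}T^{-k}\mathcal Y$, and let $\mathbb U_0$ be the set of all $u:\Omega\to U$ that are $\mathcal Y_{m,0}$-measurable for some finite $m\le 0$. A strategy $\mathbf u=(u_k)_{k\ge1}$, $u_k:\Omega\to U$, is *admissible* if $u_k$ is $\mathcal Y_{0,k}$-measurable for every $k\ge1$. For $u:\Omega\to U$ and $k\in\mathbb Z$ put $\ell_k(u)(\omega)=\ell(u(\omega),T^k\omega)$, and for $N\ge1$ let $L_N(\mathbf u)=\frac1N\sum_{k=1}^N\ell_k(u_k)$. **Theorem (Pathwise optimality).** Suppose that for some $\sigma$-field $\mathcal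 X\subseteq\mathcal B$: 1. $\mathcal X\subseteq T^{-1}\mathcal X$. 2. As $n\to\infty$, $$\operatorname*{ess\,sup}_{u\in\mathbb U_0}\big|\mathbf E[\ell_0(u)\mid\mathcal Y_{-\infty,0}\vee T^{-n}\mathcal X]-\ell_0(u)\big|\to0\quad\text{in }L^1,$$ $$\operatorname*{ess\,sup}_{u\in\mathbb U_0}\Big|\mathbf E[\ell_0(u)\mid\mathcal Y_{-\infty,0}\vee T^{n}\mathcal X]-\mathbf E\Big[\ell_0(u)\,\Big|\,\bigcap_{k=1}^\infty(\mathcal Y_{-\infty,0}\vee T^k\mathcal X)\Big]\Big|\to0\quad\text{in }L^1.$$ 3. $$L^\star:=\mathbf E\Big[\operatorname*{ess\,inf}_{u\in\mathbb U_0}\mathbf E[\ell_0(u)\mid\mathcal Y_{-\infty,0}]\Big]=\mathbf E\Big[\operatorname*{ess\,inf}_{u\in\mathbb U_0}\mathbf E\Big[\ell_0(u)\,\Big|\,\bigcap_{k=1}^\infty(\mathcal Y_{-\infty,0}\vee T^k\mathcal X)\Big]\Big].$$ Then there exists an admissible strategy $\mathbf u^\star$ such that $$\liminf_{N\to\infty}\{L_N(\mathbf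 u)-L_N(\mathbf u^\star)\}\ge0\quad\text{a.s. for every admissible strategy }\mathbf u,$$ and $\lim_{N\to\infty}L_N(\mathbf u^\star)=L^\star$ a.s. -/

import Mathlib

open Filter Topology MeasureTheory ProbabilityTheory
open scoped ENNReal

namespace SeqDecision

/-! ### Essential supremum and infimum of an arbitrary family of functions -/

/-- `g` is an essential supremum of the (arbitrary, possibly uncountable) family `f`:
a measurable extended-real function which is a.s. an upper bound of every member, and
which is a.s. below every other measurable function with this property. -/
structure IsFamilyEssSup {Ω ι : Type*} [MeasurableSpace Ω] (P : Measure Ω)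
    (f : ι → Ω → EReal) (g : Ω → EReal) : Prop where
  measurable : Measurable g
  upper : ∀ i, f i ≤ᵐ[P] g
  least : ∀ h : Ω → EReal, Measurable h → (∀ i, f i ≤ᵐ[P] h) → g ≤ᵐ[P] h

/-- `g` is an essential infimum of the family `f`. -/
structure IsFamilyEssInf {Ω ι : Type*} [MeasurableSpace Ω] (P : Measure Ω)
    (f : ι → Ω → EReal) (g : Ω → EReal) : Prop where
  measurable : Measurable g
  lower : ∀ i, g ≤ᵐ[P] f i
  greatest : ∀ h : Ω → EReal, Measurable h → (∀ i, h ≤ᵐ[P] f i) → h ≤ᵐ[P] g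

theorem exists_isFamilyEssSup {Ω ι : Type*} [MeasurableSpace Ω] (P : Measure Ω)
    [IsFiniteMeasure P] (f : ι → Ω → EReal) : ∃ g, IsFamilyEssSup P f g := by
  classical
  -- a bounded strictly increasing measurable gauge on the extended reals
  let φ : EReal → ℝ≥0∞ := fun x =>
    ((ENNReal.orderIsoIicOneBirational (EReal.expOrderIso x) : Set.Iic (1 : ℝ≥0∞)) : ℝ≥0∞)
  have φmono : StrictMono φ := fun x y h => by
    have h1 := ENNReal.orderIsoIicOneBirational.strictMono (EReal.expOrderIso.strictMono h)
    exact h1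
  have φmeas : Measurable φ := φmono.monotone.measurable
  have φle : ∀ x, φ x ≤ 1 := fun x =>
    (ENNReal.orderIsoIicOneBirational (EReal.expOrderIso x)).2
  let G : Set (Ω → EReal) := {g | Measurable g ∧ ∀ i, f i ≤ᵐ[P] g}
  have Gne : G.Nonempty :=
    ⟨fun _ => ⊤, measurable_const, fun i => Eventually.of_forall fun _ => le_top⟩
  let J : (Ω → EReal) → ℝ≥0∞ := fun g => ∫⁻ ω, φ (g ω) ∂P
  obtain ⟨c, -, hc, hcG⟩ := exists_seq_tendsto_sInf (S := J '' G) (Gne.image J)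
    (OrderBot.bddBelow _)
  choose g hgG hgJ using hcG
  let g0 : Ω → EReal := fun ω => ⨅ n, g n ω
  have hg0m : Measurable g0 := Measurable.iInf fun n => (hgG n).1
  have hg0 : g0 ∈ G := ⟨hg0m, fun i => by
    have : ∀ᵐ ω ∂P, ∀ n, f i ω ≤ g n ω := ae_all_iff.2 fun n => (hgG n).2 i
    filter_upwards [this] with ω hω using le_iInf hω⟩
  have hJ0 : J g0 ≤ sInf (J '' G) := by
    refine ge_of_tendsto' hc fun n => ?_
    rw [← hgJ n]
    exact lintegral_mono fun ω => φmono.monotone (iInf_le _ n)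
  refine ⟨g0, hg0m, hg0.2, fun h hm hh => ?_⟩
  have hk : (fun ω => g0 ω ⊓ h ω) ∈ G := ⟨hg0m.inf hm, fun i => by
    filter_upwards [hg0.2 i, hh i] with ω h1 h2 using le_inf h1 h2⟩
  have hle : J g0 ≤ J (fun ω => g0 ω ⊓ h ω) := hJ0.trans (sInf_le ⟨_, hk, rfl⟩)
  have hfin : J (fun ω => g0 ω ⊓ h ω) ≠ ∞ := by
    refine ne_top_of_le_ne_top (measure_ne_top P Set.univ) ?_
    calc J (fun ω => g0 ω ⊓ h ω) ≤ ∫⁻ _, 1 ∂P := lintegral_mono fun ω => φle _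
      _ = P Set.univ := by simp
  have hae := ae_eq_of_ae_le_of_lintegral_le
    (f := fun ω => φ (g0 ω ⊓ h ω)) (g := fun ω => φ (g0 ω)) (μ := P)
    (Eventually.of_forall fun ω => φmono.monotone inf_le_left) hfin
    (φmeas.comp hg0m).aemeasurable hle
  filter_upwards [hae] with ω hω
  have : g0 ω ⊓ h ω = g0 ω := φmono.injective hω
  exact inf_eq_left.1 this

/-- The essential supremum of a family of functions (a version of it). -/
noncomputable def familyEssSup {Ω ι : Type*} [MeasurableSpace Ω] (P : Measure Ω)
    [IsFiniteMeasure P] (f : ι → Ω → EReal) : Ω → EReal :=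
  (exists_isFamilyEssSup P f).choose

/-- The essential infimum of a family of functions (a version of it). -/
noncomputable def familyEssInf {Ω ι : Type*} [MeasurableSpace Ω] (P : Measure Ω)
    [IsFiniteMeasure P] (f : ι → Ω → EReal) : Ω → EReal :=
  fun ω => -familyEssSup P (fun i ω => -f i ω) ω

theorem isFamilyEssSup_familyEssSup {Ω ι : Type*} [MeasurableSpace Ω] (P : Measure Ω)
    [IsFiniteMeasure P] (f : ι → Ω → EReal) : IsFamilyEssSup P f (familyEssSup P f) :=
  (exists_isFamilyEssSup P f).choose_spec

theorem isFamilyEssInf_familyEssInf {Ω ι : Type*} [MeasurableSpace Ω] (P : Measure Ω)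
    [IsFiniteMeasure P] (f : ι → Ω → EReal) : IsFamilyEssInf P f (familyEssInf P f) := by
  have H := isFamilyEssSup_familyEssSup P (fun i ω => -f i ω)
  refine ⟨H.measurable.neg, fun i => ?_, fun h hm hh => ?_⟩
  · filter_upwards [H.upper i] with ω hω
    exact EReal.neg_le.1 hω
  · filter_upwards [H.least (fun ω => -h ω) hm.neg fun i => by
      filter_upwards [hh i] with ω hω using EReal.neg_le_neg_iff.2 hω] with ω hω
    exact EReal.le_neg_of_le_neg hω

/-! ### The decision problem

`T` is an invertible transformation of `Ω`; `T ^ k` for `k : ℤ` is its `k`-th iterate. -/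

/-- The σ-field `T⁻ᵏ m = {T⁻ᵏ A : A ∈ m}`, for `k : ℤ`. -/
def pull {Ω : Type*} (T : Equiv.Perm Ω) (m : MeasurableSpace Ω) (k : ℤ) : MeasurableSpace Ω :=
  m.comap (T ^ k : Equiv.Perm Ω)

/-- The σ-field `⋁_{k ∈ S} T⁻ᵏ Y` generated by the observations at the times in `S`. -/
def obs {Ω : Type*} (T : Equiv.Perm Ω) (Y : MeasurableSpace Ω) (S : Set ℤ) : MeasurableSpace Ω :=
  ⨆ k ∈ S, pull T Y k

/-- A strategy `(u_k)_{k ≥ 1}` is admissible if `u_k` is measurable with respect to the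
observations in the time interval `[0, k]` for all `k ≥ 1` (the value `u 0` is irrelevant). -/
def Admissible {Ω U : Type*} [MeasurableSpace U] (T : Equiv.Perm Ω) (Y : MeasurableSpace Ω)
    (u : ℕ → Ω → U) : Prop :=
  ∀ k : ℕ, 1 ≤ k → Measurable[obs T Y (Set.Icc 0 (k : ℤ))] (u k)

/-- The decisions at time `n` that depend on the observations in `[m, n]` for some finite
`m ≤ n`. -/
def decisions {Ω : Type*} (U : Type*) [MeasurableSpace U] (T : Equiv.Perm Ω)
    (Y : MeasurableSpace Ω) (n : ℤ) : Set (Ω → U) :=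
  {u | ∃ m : ℤ, m ≤ n ∧ Measurable[obs T Y (Set.Icc m n)] u}

/-- The loss `ℓ_k(u)(ω) = ℓ(u(ω), T^k ω)` of the decision `u` at time `k`. -/
def loss {Ω U : Type*} (ℓ : U → Ω → ℝ) (T : Equiv.Perm Ω) (k : ℤ) (u : Ω → U) : Ω → ℝ :=
  fun ω => ℓ (u ω) ((T ^ k : Equiv.Perm Ω) ω)

/-- The time-average loss `L_N(u) = N⁻¹ ∑_{k=1}^N ℓ_k(u_k)`. -/
noncomputable def avgLoss {Ω U : Type*} (ℓ : U → Ω → ℝ) (T : Equiv.Perm Ω) (u : ℕ → Ω → U)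
    (N : ℕ) (ω : Ω) : ℝ :=
  (1 / (N : ℝ)) * ∑ k ∈ Finset.Icc 1 N, loss ℓ T k (u k) ω

/-- `ustar` is pathwise optimal: it is admissible, and for every admissible `u`,
`liminf_N (L_N(u) - L_N(ustar)) ≥ 0` a.s. -/
def PathwiseOptimal {Ω U : Type*} (Y : MeasurableSpace Ω) [MeasurableSpace Ω] [MeasurableSpace U]
    (P : Measure Ω) (T : Equiv.Perm Ω) (ℓ : U → Ω → ℝ) (ustar : ℕ → Ω → U) : Prop :=
  Admissible T Y ustar ∧ ∀ u : ℕ → Ω → U, Admissible T Y u →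
    ∀ᵐ ω ∂P, (0 : EReal) ≤
      liminf (fun N : ℕ => ((avgLoss ℓ T u N ω - avgLoss ℓ T ustar N ω : ℝ) : EReal)) atTop

/-- The `L¹` norm of `ess sup |F u - G u|`, over the decisions `u` at time `0` that depend on
finitely many past observations. -/
noncomputable def uniformL1Dist {Ω U : Type*} (Y : MeasurableSpace Ω) [MeasurableSpace Ω]
    [MeasurableSpace U] (P : Measure Ω) [IsFiniteMeasure P] (T : Equiv.Perm Ω)
    (F G : (Ω → U) → Ω → ℝ) : ℝ≥0∞ :=
  ∫⁻ ω, (familyEssSup P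
    (fun (u : decisions U T Y 0) ω => ((|F u ω - G u ω| : ℝ) : EReal)) ω).abs ∂P

/-- `E[ess inf_u E[ℓ_0(u) | m]]`, over the decisions `u` at time `0` that depend on
finitely many past observations. -/
noncomputable def expectedInfLoss {Ω U : Type*} (Y m : MeasurableSpace Ω) [MeasurableSpace Ω]
    [MeasurableSpace U] (P : Measure Ω) [IsFiniteMeasure P] (T : Equiv.Perm Ω)
    (ℓ : U → Ω → ℝ) : ℝ :=
  ∫ ω, (familyEssInf P
    (fun (u : decisions U T Y 0) ω => ((P[loss ℓ T 0 u | m] ω : ℝ) : EReal)) ω).toReal ∂P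

/-- `L⋆ = E[ess inf_u E[ℓ_0(u) | Y_{-∞,0}]]`. -/
noncomputable def Lstar {Ω U : Type*} (Y : MeasurableSpace Ω) [MeasurableSpace Ω]
    [MeasurableSpace U] (P : Measure Ω) [IsFiniteMeasure P] (T : Equiv.Perm Ω)
    (ℓ : U → Ω → ℝ) : ℝ :=
  expectedInfLoss Y (obs T Y (Set.Iic 0)) P T ℓ

/-- The σ-field `Y_{-∞,0} ∨ T^k X`, for `k : ℤ`. -/
def augmented {Ω : Type*} (T : Equiv.Perm Ω) (Y X : MeasurableSpace Ω) (k : ℤ) :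
    MeasurableSpace Ω :=
  obs T Y (Set.Iic 0) ⊔ pull T X (-k)

/-- The σ-field `⋂_{k ≥ 1} (Y_{-∞,0} ∨ T^k X)`. -/
def remote {Ω : Type*} (T : Equiv.Perm Ω) (Y X : MeasurableSpace Ω) : MeasurableSpace Ω :=
  ⨅ k : ℕ, ⨅ _ : 1 ≤ k, augmented T Y X k

end SeqDecision

/-! Shifted by `T ^ (-k)`, the time-`k` decision of an admissible strategy becomes a decision at
time `0`, and its loss becomes `loss ℓ T 0` of the shifted decision, evaluated at `T^[k] ω`. The
heart of the proof is `avgBound_loss_sub_condExp_remote`: for any sequence of decisions at time `0`,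
these losses may be replaced in time averages by their conditional expectations given `remote T Y
X`, evaluated at `T^[k] ω`.

The difference telescopes along the decreasing σ-fields `augmented T Y X j`, with `j` running from
`-n` to `n'`. By condition 2 the two end terms are dominated, uniformly over decisions, by
integrable functions of small mean, and the ergodic theorem bounds their averages. Each of the
finitely many middle terms is a sequence of martingale differences, because shifting back by one or
more steps carries level `j` into level `j + 1`; after truncation it obeys a law of large numbers
for bounded orthogonal variables. As domination only yields bounds by a given `ε`, everything is
phrased through `AvgBound`.

Optimality: the conditional expectation given `remote T Y X` is at least the essential infimum
`infLoss`, a fixed integrable function with mean `L⋆` by condition 3. By the ergodic theorem no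
strategy asymptotically beats `L⋆`.

Attainment: pick decisions `w n` with expected loss at most `L⋆ + 2⁻ⁿ`. By condition 3 their
conditional losses given `remote T Y X` are within `2⁻ⁿ` of `infLoss` in `L¹`. Summability of these
errors provides integrable majorants of small mean, and playing the `w n` slowly enough respects
admissibility. -/

namespace SeqDecision

/-! ### Pointwise ergodic theorem, upper half, via maximal Birkhoff sums -/

section Ergodic

variable {Ω : Type*} {T : Ω → Ω}

/-- The running maximum of the Birkhoff sums. -/
noncomputable def maxBirkhoffSum (T : Ω → Ω) (f : Ω → ℝ) : ℕ → Ω → ℝ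
  | 0 => 0
  | n + 1 => fun ω => max 0 (f ω + maxBirkhoffSum T f n (T ω))

theorem maxBirkhoffSum_nonneg (f : Ω → ℝ) (n : ℕ) (ω : Ω) : 0 ≤ maxBirkhoffSum T f n ω := by
  cases n with
  | zero => exact le_rfl
  | succ n => exact le_max_left _ _

theorem maxBirkhoffSum_le_succ (f : Ω → ℝ) (n : ℕ) (ω : Ω) :
    maxBirkhoffSum T f n ω ≤ maxBirkhoffSum T f (n + 1) ω := by
  induction n generalizing ω with
  | zero => exact maxBirkhoffSum_nonneg _ _ _
  | succ n ih =>
    have := ih (T ω)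
    exact max_le_max le_rfl (by linarith)

theorem birkhoffSum_le_maxBirkhoffSum (f : Ω → ℝ) (n : ℕ) (ω : Ω) :
    birkhoffSum T f n ω ≤ maxBirkhoffSum T f n ω := by
  induction n generalizing ω with
  | zero => simp [maxBirkhoffSum]
  | succ n ih =>
    rw [birkhoffSum_succ']
    exact le_max_of_le_right (by linarith [ih (T ω)])

theorem birkhoffSum_comp_eq_sum_Icc (f : Ω → ℝ) (n : ℕ) (ω : Ω) :
    birkhoffSum T (fun ω => f (T ω)) n ω = ∑ k ∈ Finset.Icc 1 n, f (T^[k] ω) := by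
  induction n with
  | zero => simp
  | succ n ih =>
    rw [birkhoffSum_succ, ih, Finset.sum_Icc_succ_top (by omega), Function.iterate_succ_apply']

variable [MeasurableSpace Ω] {P : Measure Ω}

theorem integrable_maxBirkhoffSum (hT : MeasurePreserving T P P) {f : Ω → ℝ}
    (hf : Integrable f P) (n : ℕ) : Integrable (maxBirkhoffSum T f n) P := by
  induction n with
  | zero => exact integrable_zero _ _ _
  | succ n ih =>
    exact (integrable_zero _ _ _).sup (hf.add (hT.integrable_comp_of_integrable ih))

theorem measurable_birkhoffSum (hT : Measurable T) {f : Ω → ℝ} (hf : Measurable f) (n : ℕ) :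
    Measurable (birkhoffSum T f n) :=
  Finset.measurable_sum _ fun k _ => hf.comp (hT.iterate k)

/-- If `∫ f < 0` then the Birkhoff sums of `f` are a.s. bounded above. -/
theorem ae_bddAbove_birkhoffSum (hT : Ergodic T P) {f : Ω → ℝ} (hfm : Measurable f)
    (hf : Integrable f P) (hneg : ∫ ω, f ω ∂P < 0) :
    ∀ᵐ ω ∂P, BddAbove (Set.range fun n => birkhoffSum T f n ω) := by
  set E : Set Ω := {ω | BddAbove (Set.range fun n => birkhoffSum T f n ω)} with hE
  have hEm : MeasurableSet E :=
    measurableSet_bddAbove_range fun n => measurable_birkhoffSum hT.measurable hfm n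
  have hinv : T ⁻¹' E = E := by
    ext ω
    constructor
    · rintro ⟨C, hC⟩
      refine ⟨max 0 (f ω + C), ?_⟩
      rintro _ ⟨n, rfl⟩
      cases n with
      | zero => simp
      | succ n =>
        have := hC ⟨n, rfl⟩
        simp only [birkhoffSum_succ'] at this ⊢
        exact le_max_of_le_right (by linarith)
    · rintro ⟨C, hC⟩
      refine ⟨C - f ω, ?_⟩
      rintro _ ⟨n, rfl⟩
      have := hC ⟨n + 1, rfl⟩
      simp only [birkhoffSum_succ'] at this ⊢
      linarith
  rcases hT.toPreErgodic.ae_mem_or_ae_notMem hEm hinv with h | h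
  · exact h
  exfalso
  -- The integrand equals `max (-M n (T ω)) (f ω)`, with `M n` the running maximum: it is bounded by
  -- `|f|` and equals `f` as soon as `M n (T ω) ≥ -f ω`, which happens when the sums are unbounded.
  -- Its integral is nonnegative by invariance of `P` and monotonicity of `M`, contradicting `∫ f <
  -- 0`.
  have hlim : Tendsto (fun n => ∫ ω, (maxBirkhoffSum T f (n + 1) ω - maxBirkhoffSum T f n (T ω)) ∂P)
      atTop (𝓝 (∫ ω, f ω ∂P)) := by
    refine tendsto_integral_of_dominated_convergence (fun ω => |f ω|) (fun n => ?_) hf.abs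
      (fun n => Eventually.of_forall fun ω => ?_) ?_
    · exact ((integrable_maxBirkhoffSum hT.toMeasurePreserving hf _).sub
        (hT.toMeasurePreserving.integrable_comp_of_integrable
          (integrable_maxBirkhoffSum hT.toMeasurePreserving hf _))).aestronglyMeasurable
    · have h0 := maxBirkhoffSum_nonneg (T := T) f n (T ω)
      simp only [maxBirkhoffSum, Real.norm_eq_abs]
      rw [abs_le]
      have h1 := neg_abs_le (f ω)
      have h2 := le_abs_self (f ω)
      refine ⟨?_, ?_⟩
      · have := le_max_right 0 (f ω + maxBirkhoffSum T f n (T ω))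
        linarith
      · have : max 0 (f ω + maxBirkhoffSum T f n (T ω)) ≤ |f ω| + maxBirkhoffSum T f n (T ω) :=
          max_le (by positivity) (by linarith)
        linarith
    · filter_upwards [h] with ω hω
      have hω' : T ω ∉ E := fun h' => hω (by rw [← hinv]; exact h')
      refine tendsto_const_nhds.congr' ?_
      have hub : ¬ BddAbove (Set.range fun n => maxBirkhoffSum T f n (T ω)) := by
        rintro ⟨C, hC⟩
        refine hω' ⟨C, ?_⟩
        rintro _ ⟨n, rfl⟩
        exact (birkhoffSum_le_maxBirkhoffSum f n _).trans (hC ⟨n, rfl⟩)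
      have htop := tendsto_atTop_atTop_of_monotone
        (monotone_nat_of_le_succ fun n => maxBirkhoffSum_le_succ (T := T) f n (T ω)) fun b => by
          obtain ⟨_, ⟨n, rfl⟩, hn⟩ := not_bddAbove_iff.1 hub b
          exact ⟨n, hn.le⟩
      filter_upwards [htop.eventually_ge_atTop (-f ω)] with n hn
      simp only [maxBirkhoffSum]
      rw [max_eq_right (by linarith)]
      ring
  have hnonneg : ∀ n, 0 ≤ ∫ ω, (maxBirkhoffSum T f (n + 1) ω - maxBirkhoffSum T f n (T ω)) ∂P := by
    intro n
    have hi := integrable_maxBirkhoffSum hT.toMeasurePreserving hf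
    have hs := integral_sub (hi (n + 1)) (hT.toMeasurePreserving.integrable_comp_of_integrable (hi n))
    simp only [Function.comp_apply] at hs
    rw [hs]
    have : ∫ ω, maxBirkhoffSum T f n (T ω) ∂P = ∫ ω, maxBirkhoffSum T f n ω ∂P := by
      rw [← integral_map hT.measurable.aemeasurable, hT.map_eq]
      rw [hT.map_eq]; exact (hi n).aestronglyMeasurable
    rw [this, sub_nonneg]
    exact integral_mono (hi _) (hi _) fun ω => maxBirkhoffSum_le_succ f n ω
  exact absurd (ge_of_tendsto' hlim hnonneg) (not_le.2 hneg)

/-- The upper half of the pointwise ergodic theorem. -/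
theorem ae_eventually_birkhoffSum_le [IsProbabilityMeasure P] (hT : Ergodic T P) {f : Ω → ℝ}
    (hf : Integrable f P) {a : ℝ} (ha : ∫ ω, f ω ∂P < a) :
    ∀ᵐ ω ∂P, ∀ᶠ n : ℕ in atTop, birkhoffSum T f n ω ≤ a * n := by
  -- The sums of `f - b` are a.s. bounded above by some `C`; the slack `(a - b) * n` eventually
  -- absorbs `C`.
  obtain ⟨b, hb1, hb2⟩ := exists_between ha
  set g := hf.aestronglyMeasurable.mk f
  have hfg : f =ᵐ[P] g := hf.aestronglyMeasurable.ae_eq_mk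
  have hg : Integrable g P := hf.congr hfg
  have hint : ∫ ω, (g ω - b) ∂P < 0 := by
    rw [integral_sub hg (integrable_const _), ← integral_congr_ae hfg]
    simpa using hb1
  have hall : ∀ᵐ ω ∂P, ∀ k : ℕ, f (T^[k] ω) = g (T^[k] ω) := ae_all_iff.2 fun k =>
    (hT.toMeasurePreserving.iterate k).quasiMeasurePreserving.ae hfg
  filter_upwards [ae_bddAbove_birkhoffSum (f := fun ω => g ω - b) hT
    (hf.aestronglyMeasurable.stronglyMeasurable_mk.measurable.sub measurable_const)
    (hg.sub (integrable_const _)) hint, hall] with ω ⟨C, hC⟩ hω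
  have htop : Tendsto (fun n : ℕ => (a - b) * (n : ℝ)) atTop atTop :=
    tendsto_natCast_atTop_atTop.const_mul_atTop (sub_pos.2 hb2)
  filter_upwards [htop.eventually_ge_atTop C] with n hn
  have h1 := hC ⟨n, rfl⟩
  simp only [birkhoffSum, Finset.sum_sub_distrib, Finset.sum_const, Finset.card_range,
    nsmul_eq_mul] at h1 ⊢
  rw [Finset.sum_congr rfl fun k _ => hω k]
  linarith

theorem ae_eventually_sum_Icc_le [IsProbabilityMeasure P] (hT : Ergodic T P) {f : Ω → ℝ}
    (hf : Integrable f P) {a : ℝ} (ha : ∫ ω, f ω ∂P < a) :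
    ∀ᵐ ω ∂P, ∀ᶠ n : ℕ in atTop, ∑ k ∈ Finset.Icc 1 n, f (T^[k] ω) ≤ a * n := by
  have : ∫ ω, f (T ω) ∂P = ∫ ω, f ω ∂P := by
    rw [← integral_map hT.measurable.aemeasurable, hT.map_eq]
    rw [hT.map_eq]; exact hf.aestronglyMeasurable
  have h := ae_eventually_birkhoffSum_le hT
    (hT.toMeasurePreserving.integrable_comp_of_integrable hf) (a := a) (this.trans_lt ha)
  simp only [Function.comp_def, birkhoffSum_comp_eq_sum_Icc] at h
  exact h

end Ergodic

/-! ### Asymptotic bounds on averages; law of large numbers for orthogonal variables -/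

section Averages

variable {Ω : Type*} [MeasurableSpace Ω] {P : Measure Ω}

/-- Almost surely, the averages `N⁻¹ ∑_{k=1}^N a_k` are eventually at most `ε` in absolute value. -/
def AvgBound (P : Measure Ω) (a : ℕ → Ω → ℝ) (ε : ℝ) : Prop :=
  ∀ᵐ ω ∂P, ∀ᶠ N : ℕ in atTop, |∑ k ∈ Finset.Icc 1 N, a k ω| ≤ ε * N

theorem AvgBound.add {a b : ℕ → Ω → ℝ} {ε δ : ℝ} (ha : AvgBound P a ε) (hb : AvgBound P b δ) :
    AvgBound P (fun k ω => a k ω + b k ω) (ε + δ) := by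
  filter_upwards [ha, hb] with ω h1 h2
  filter_upwards [h1, h2] with N h1 h2
  rw [Finset.sum_add_distrib]
  exact (abs_add_le _ _).trans (by linarith)

theorem AvgBound.congr {a b : ℕ → Ω → ℝ} {ε : ℝ} (ha : AvgBound P a ε)
    (h : ∀ k, a k =ᵐ[P] b k) : AvgBound P b ε := by
  filter_upwards [ha, ae_all_iff.2 h] with ω h1 h2
  filter_upwards [h1] with N h1
  rwa [← Finset.sum_congr rfl fun k _ => h2 k]

theorem AvgBound.sum {ι : Type*} (s : Finset ι) {a : ι → ℕ → Ω → ℝ}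
    (ha : ∀ i ∈ s, ∀ ε > 0, AvgBound P (a i) ε) {ε : ℝ} (hε : 0 < ε) :
    AvgBound P (fun k ω => ∑ i ∈ s, a i k ω) ε := by
  classical
  induction s using Finset.induction_on generalizing ε with
  | empty =>
    refine Eventually.of_forall fun ω => Eventually.of_forall fun N => ?_
    simp only [Finset.sum_empty, Finset.sum_const_zero, abs_zero]
    positivity
  | insert i s hi ih =>
    simp only [Finset.sum_insert hi]
    rw [← add_halves ε]
    exact (ha i (Finset.mem_insert_self _ _) _ (half_pos hε)).add
      (ih (fun j hj => ha j (Finset.mem_insert_of_mem hj)) (half_pos hε))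

theorem tendsto_avg_of_avgBound {a : ℕ → Ω → ℝ} (ha : ∀ ε > 0, AvgBound P a ε) :
    ∀ᵐ ω ∂P, Tendsto (fun N : ℕ => (1 / (N : ℝ)) * ∑ k ∈ Finset.Icc 1 N, a k ω) atTop (𝓝 0) := by
  have h : ∀ᵐ ω ∂P, ∀ n : ℕ, ∀ᶠ N : ℕ in atTop,
      |∑ k ∈ Finset.Icc 1 N, a k ω| ≤ 1 / ((n : ℝ) + 1) * N :=
    ae_all_iff.2 fun n => ha _ (by positivity)
  filter_upwards [h] with ω hω
  rw [Metric.tendsto_atTop']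
  intro ε hε
  obtain ⟨n, hn⟩ := exists_nat_one_div_lt hε
  obtain ⟨N0, hN0⟩ := eventually_atTop.1 (hω n)
  refine ⟨N0, fun N hN => ?_⟩
  have hNpos : (0 : ℝ) < N := by exact_mod_cast (Nat.zero_le _).trans_lt hN
  rw [Real.dist_eq, sub_zero, abs_mul, abs_of_pos (by positivity), one_div, inv_mul_lt_iff₀ hNpos]
  have := hN0 N hN.le
  nlinarith

/-- Averages along an ergodic transformation of a sequence that is eventually dominated by an
integrable function. -/
theorem avgBound_of_eventually_le [IsProbabilityMeasure P] {T : Ω → Ω} (hT : Ergodic T P)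
    {f : ℕ → Ω → ℝ} {d : Ω → ℝ} (hd : Integrable d P)
    (hfd : ∀ᶠ k in atTop, ∀ᵐ ω ∂P, |f k ω| ≤ d ω) {ε : ℝ} (hε : ∫ ω, d ω ∂P < ε) :
    AvgBound P (fun k ω => f k (T^[k] ω)) ε := by
  obtain ⟨δ, hδ1, hδ2⟩ := exists_between hε
  obtain ⟨K, hK⟩ := eventually_atTop.1 hfd
  have hall : ∀ᵐ ω ∂P, ∀ k, K ≤ k → |f k (T^[k] ω)| ≤ d (T^[k] ω) := by
    refine ae_all_iff.2 fun k => ?_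
    by_cases hk : K ≤ k
    · filter_upwards [(hT.toMeasurePreserving.iterate k).quasiMeasurePreserving.ae (hK k hk)]
        with ω hω _ using hω
    · exact Eventually.of_forall fun ω h => absurd h hk
  filter_upwards [hall, ae_eventually_sum_Icc_le hT hd hδ1] with ω h1 h2
  have htop : Tendsto (fun n : ℕ => (ε - δ) * (n : ℝ)) atTop atTop :=
    tendsto_natCast_atTop_atTop.const_mul_atTop (sub_pos.2 hδ2)
  -- Cost of the first `K` terms, where the domination may fail; it is absorbed by `(ε - δ) * N`.
  set C : ℝ := ∑ k ∈ Finset.range K, (|f k (T^[k] ω)| + |d (T^[k] ω)|)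
  filter_upwards [h2, htop.eventually_ge_atTop C] with N h2 h3
  have key : ∑ k ∈ Finset.Icc 1 N, |f k (T^[k] ω)| ≤
      ∑ k ∈ Finset.Icc 1 N, d (T^[k] ω) + C := by
    rw [← sub_le_iff_le_add', ← Finset.sum_sub_distrib]
    calc ∑ k ∈ Finset.Icc 1 N, (|f k (T^[k] ω)| - d (T^[k] ω))
        ≤ ∑ k ∈ Finset.Icc 1 N with k < K, (|f k (T^[k] ω)| + |d (T^[k] ω)|) := by
          rw [Finset.sum_filter]
          refine Finset.sum_le_sum fun k _ => ?_
          split_ifs with hk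
          · linarith [neg_abs_le (d (T^[k] ω))]
          · linarith [h1 k (not_lt.1 hk)]
      _ ≤ C := by
          refine Finset.sum_le_sum_of_subset_of_nonneg (fun k hk => ?_) fun _ _ _ => by positivity
          simpa using (Finset.mem_filter.1 hk).2
  calc _ ≤ ∑ k ∈ Finset.Icc 1 N, |f k (T^[k] ω)| := Finset.abs_sum_le_sum_abs _ _
    _ ≤ _ := key
    _ ≤ ε * N := by linarith

theorem integral_sq_sum_Icc_le [IsProbabilityMeasure P] {X : ℕ → Ω → ℝ} {C : ℝ}
    (hX : ∀ k, AEStronglyMeasurable (X k) P) (hC : ∀ k, ∀ᵐ ω ∂P, |X k ω| ≤ C)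
    (horth : ∀ i k, i < k → ∫ ω, X i ω * X k ω ∂P = 0) (N : ℕ) :
    ∫ ω, (∑ k ∈ Finset.Icc 1 N, X k ω) ^ 2 ∂P ≤ C ^ 2 * N := by
  have hint : ∀ i k, Integrable (fun ω => X i ω * X k ω) P := fun i k =>
    Integrable.of_bound ((hX i).mul (hX k)) (C * C) <| by
      filter_upwards [hC i, hC k] with ω h1 h2
      rw [norm_mul]
      exact mul_le_mul h1 h2 (norm_nonneg _) ((abs_nonneg _).trans h1)
  have hexp : ∀ ω, (∑ k ∈ Finset.Icc 1 N, X k ω) ^ 2 =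
      ∑ i ∈ Finset.Icc 1 N, ∑ k ∈ Finset.Icc 1 N, X i ω * X k ω := fun ω => by
    rw [sq, Finset.sum_mul_sum]
  simp only [hexp]
  rw [integral_finsetSum _ fun i _ => integrable_finsetSum _ fun k _ => hint i k]
  calc _ ≤ ∑ i ∈ Finset.Icc 1 N, C ^ 2 := by
        refine Finset.sum_le_sum fun i hi => ?_
        rw [integral_finsetSum _ fun k _ => hint i k, Finset.sum_eq_single_of_mem i hi]
        · calc ∫ ω, X i ω * X i ω ∂P ≤ ∫ ω, C ^ 2 ∂P := by
                refine integral_mono_ae (hint i i) (integrable_const _) ?_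
                filter_upwards [hC i] with ω h
                rw [← sq]
                exact sq_le_sq' (abs_le.1 h).1 (abs_le.1 h).2
            _ = C ^ 2 := by simp
        · intro k _ hk
          rcases lt_or_gt_of_ne hk with h | h
          · simpa only [mul_comm] using horth k i h
          · exact horth i k h
    _ = C ^ 2 * N := by simp [mul_comm]

/-- The strong law of large numbers for bounded orthogonal random variables. -/
theorem avgBound_of_orthogonal [IsProbabilityMeasure P] {X : ℕ → Ω → ℝ} {C : ℝ}
    (hX : ∀ k, AEStronglyMeasurable (X k) P) (hC : ∀ k, ∀ᵐ ω ∂P, |X k ω| ≤ C)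
    (horth : ∀ i k, i < k → ∫ ω, X i ω * X k ω ∂P = 0) {ε : ℝ} (hε : 0 < ε) :
    AvgBound P X ε := by
  set S : ℕ → Ω → ℝ := fun N ω => ∑ k ∈ Finset.Icc 1 N, X k ω with hS
  have hC0 : 0 ≤ C := by
    obtain ⟨ω, hω⟩ := (hC 0).exists
    exact (abs_nonneg _).trans hω
  have hSm : ∀ N, AEStronglyMeasurable (S N) P := fun N =>
    Finset.aestronglyMeasurable_fun_sum _ fun k _ => hX k
  have hSb : ∀ N, ∀ᵐ ω ∂P, |S N ω| ≤ C * N := fun N => by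
    filter_upwards [ae_all_iff.2 hC] with ω hω
    calc _ ≤ ∑ k ∈ Finset.Icc 1 N, |X k ω| := Finset.abs_sum_le_sum_abs _ _
      _ ≤ ∑ k ∈ Finset.Icc 1 N, C := Finset.sum_le_sum fun k _ => hω k
      _ = _ := by simp [mul_comm]
  -- Along the squares `(m + 1) ^ 2` the second moments of the averages are at most `C ^ 2 / (m + 1)
  -- ^ 2`, which is summable, so these averages tend to zero a.s.
  set Z : ℕ → Ω → ℝ≥0∞ := fun m ω => ENNReal.ofReal ((S ((m + 1) ^ 2) ω / ((m : ℝ) + 1) ^ 2) ^ 2)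
  have hZ : ∀ m, ∫⁻ ω, Z m ω ∂P ≤ ENNReal.ofReal (C ^ 2 * (1 / ((m : ℝ) + 1) ^ 2)) := fun m => by
    have hi : Integrable (fun ω => (S ((m + 1) ^ 2) ω / ((m : ℝ) + 1) ^ 2) ^ 2) P := by
      refine Integrable.of_bound (((hSm _).aemeasurable.div_const _).pow_const 2).aestronglyMeasurable
        (C ^ 2) ?_
      filter_upwards [hSb ((m + 1) ^ 2)] with ω h
      rw [Real.norm_eq_abs, abs_pow, abs_div, abs_of_pos (by positivity : (0 : ℝ) < ((m : ℝ) + 1) ^ 2)]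
      gcongr
      rw [div_le_iff₀ (by positivity)]
      exact_mod_cast h
    rw [← ofReal_integral_eq_lintegral_ofReal hi (Eventually.of_forall fun _ => sq_nonneg _)]
    refine ENNReal.ofReal_le_ofReal ?_
    simp only [div_pow, integral_div]
    have := integral_sq_sum_Icc_le hX hC horth ((m + 1) ^ 2)
    rw [div_le_iff₀ (by positivity)]
    refine this.trans (le_of_eq ?_)
    push_cast
    field_simp
  have hsum : ∑' m : ℕ, ENNReal.ofReal (C ^ 2 * (1 / ((m : ℝ) + 1) ^ 2)) ≠ ∞ := by
    have : Summable fun m : ℕ => C ^ 2 * (1 / ((m : ℝ) + 1) ^ 2) := by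
      have h := (summable_nat_add_iff 1).2 (Real.summable_one_div_nat_pow.2 one_lt_two)
      simpa using h.mul_left (C ^ 2)
    exact this.tsum_ofReal_ne_top
  have hZm : ∀ m, AEMeasurable (Z m) P := fun m =>
    (((hSm _).aemeasurable.div_const _).pow_const 2).ennreal_ofReal
  have hfin : ∀ᵐ ω ∂P, ∑' m, Z m ω < ∞ := by
    refine ae_lt_top' (AEMeasurable.tsum hZm) ?_
    rw [lintegral_tsum hZm]
    exact ne_top_of_le_ne_top hsum (ENNReal.tsum_le_tsum hZ)
  filter_upwards [hfin, ae_all_iff.2 hC] with ω hω hCω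
  have hZ0 : Tendsto (fun m => Z m ω) atTop (𝓝 0) :=
    ENNReal.tendsto_atTop_zero_of_tsum_ne_top hω.ne
  have hev : ∀ᶠ m : ℕ in atTop, |S ((m + 1) ^ 2) ω| ≤ ε / 2 * ((m : ℝ) + 1) ^ 2 := by
    filter_upwards [hZ0.eventually_lt_const
      (ENNReal.ofReal_pos.2 (by positivity : 0 < (ε / 2) ^ 2))] with m hm
    have := (ENNReal.ofReal_lt_ofReal_iff (by positivity)).1 hm
    have h3 := abs_lt_of_sq_lt_sq this (by positivity)
    rw [abs_div, abs_of_pos (by positivity : (0 : ℝ) < ((m : ℝ) + 1) ^ 2),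
      div_lt_iff₀ (by positivity)] at h3
    exact h3.le
  have hsq : Tendsto (fun N : ℕ => Nat.sqrt N) atTop atTop :=
    tendsto_atTop_atTop.2 fun b => ⟨b * b, fun a ha => Nat.le_sqrt.2 ha⟩
  obtain ⟨M, hM⟩ := eventually_atTop.1 hev
  -- At most `2 * (m + 1)` terms lie beyond the last square; their sum is at most `ε / 2 * (m + 1) ^
  -- 2` once `m + 1 ≥ 4 * C / ε`.
  obtain ⟨K, hK⟩ := exists_nat_ge (4 * C / ε)
  filter_upwards [hsq.eventually_ge_atTop (M + K + 1)] with N hN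
  obtain ⟨m, hm⟩ : ∃ m, Nat.sqrt N = m + 1 := ⟨Nat.sqrt N - 1, by omega⟩
  have hN1 : (m + 1) ^ 2 ≤ N := by rw [← hm]; exact Nat.sqrt_le' N
  have hN2 : N ≤ (m + 1) ^ 2 + 2 * (m + 1) := by
    have := Nat.sqrt_le_add N
    rw [hm] at this
    nlinarith
  have h1 := hM m (by omega)
  have hsplit : ∑ k ∈ Finset.Icc 1 N, X k ω =
      S ((m + 1) ^ 2) ω + ∑ k ∈ Finset.Ioc ((m + 1) ^ 2) N, X k ω := by
    have : ∀ n : ℕ, Finset.Icc 1 n = Finset.Ioc 0 n := fun n => by ext; simp; omega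
    simp only [hS, this]
    rw [Finset.sum_Ioc_consecutive _ (Nat.zero_le _) hN1]
  have htail : |∑ k ∈ Finset.Ioc ((m + 1) ^ 2) N, X k ω| ≤ C * (2 * ((m : ℝ) + 1)) := by
    calc _ ≤ ∑ k ∈ Finset.Ioc ((m + 1) ^ 2) N, |X k ω| := Finset.abs_sum_le_sum_abs _ _
      _ ≤ ∑ k ∈ Finset.Ioc ((m + 1) ^ 2) N, C := Finset.sum_le_sum fun k _ => hCω k
      _ = C * ((N - (m + 1) ^ 2 : ℕ) : ℝ) := by simp [mul_comm]
      _ ≤ C * (2 * ((m : ℝ) + 1)) := by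
          gcongr
          have : N - (m + 1) ^ 2 ≤ 2 * (m + 1) := by omega
          exact_mod_cast this
  have hKm : 4 * C / ε ≤ (m : ℝ) + 1 := hK.trans (by exact_mod_cast (by omega : K ≤ m + 1))
  rw [div_le_iff₀ hε] at hKm
  have hN1' : ((m : ℝ) + 1) ^ 2 ≤ N := by exact_mod_cast hN1
  have hm0 : (0 : ℝ) ≤ (m : ℝ) + 1 := by positivity
  rw [hsplit]
  calc _ ≤ _ := abs_add_le _ _
    _ ≤ ε / 2 * ((m : ℝ) + 1) ^ 2 + C * (2 * ((m : ℝ) + 1)) := add_le_add h1 htail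
    _ ≤ ε * ((m : ℝ) + 1) ^ 2 := by nlinarith
    _ ≤ ε * N := by gcongr

end Averages

/-! ### Stationary martingale differences -/

section MartingaleDifferences

variable {Ω : Type*} [mΩ : MeasurableSpace Ω] {P : Measure Ω}

theorem abs_condExp_le_condExp {m : MeasurableSpace Ω} {f g : Ω → ℝ} (hf : Integrable f P)
    (hg : Integrable g P) (h : ∀ᵐ ω ∂P, |f ω| ≤ g ω) : ∀ᵐ ω ∂P, |P[f|m] ω| ≤ P[g|m] ω := by
  have h1 := condExp_mono (m := m) hf hg (h.mono fun ω h => (abs_le.1 h).2)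
  have h2 := condExp_mono (m := m) hg.neg hf (h.mono fun ω h => (abs_le.1 h).1)
  filter_upwards [h1, h2, condExp_neg (μ := P) g m] with ω h1 h2 h3
  rw [h3] at h2
  exact abs_le.2 ⟨h2, h1⟩

theorem abs_condExp_sub_condExp_le {Ω : Type*} {m m' : MeasurableSpace Ω} [MeasurableSpace Ω]
    {P : Measure Ω} {f g d : Ω → ℝ}
    (hf : Integrable f P) (hg : Integrable g P) (hd : Integrable d P)
    (h : ∀ ω, |f ω - g ω| ≤ d ω) :
    ∀ᵐ ω ∂P, |(P[f|m] ω - P[f|m'] ω) - (P[g|m] ω - P[g|m'] ω)| ≤ P[d|m] ω + P[d|m'] ω := by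
  have h' : ∀ᵐ ω ∂P, |(f - g) ω| ≤ d ω := Eventually.of_forall h
  filter_upwards [condExp_sub hf hg m, condExp_sub hf hg m',
    abs_condExp_le_condExp (m := m) (hf.sub hg) hd h',
    abs_condExp_le_condExp (m := m') (hf.sub hg) hd h'] with ω h1 h2 h3 h4
  rw [h1] at h3
  rw [h2] at h4
  simp only [Pi.sub_apply] at h3 h4
  calc _ = |(P[f|m] ω - P[g|m] ω) - (P[f|m'] ω - P[g|m'] ω)| := by ring_nf
    _ ≤ _ := abs_sub _ _
    _ ≤ _ := add_le_add h3 h4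

/-- By the tower property the difference has zero conditional expectation given `E`, and the bounded
`E`-measurable factor `Z` can be pulled out. -/
theorem integral_mul_condExp_sub_condExp [IsFiniteMeasure P] {E F : MeasurableSpace Ω}
    (hEF : E ≤ F) (hF : F ≤ mΩ) {g Z : Ω → ℝ} (hZ : StronglyMeasurable[E] Z)
    {C : ℝ} (hC : ∀ᵐ ω ∂P, |Z ω| ≤ C) : ∫ ω, Z ω * (P[g|F] ω - P[g|E] ω) ∂P = 0 := by
  have hD : Integrable (P[g|F] - P[g|E]) P := integrable_condExp.sub integrable_condExp
  have hZD : Integrable (Z * (P[g|F] - P[g|E])) P :=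
    hD.bdd_mul (hZ.mono (hEF.trans hF)).aestronglyMeasurable hC
  have h0 : P[P[g|F] - P[g|E]|E] =ᵐ[P] 0 := by
    filter_upwards [condExp_sub (m := E) (integrable_condExp (f := g) (m := F) (μ := P))
      (integrable_condExp (f := g) (m := E)), condExp_condExp_of_le (f := g) (μ := P) hEF hF,
      condExp_condExp_of_le (f := g) (μ := P) le_rfl (hEF.trans hF)] with ω h1 h2 h3
    rw [h1, Pi.sub_apply, h2, h3, sub_self, Pi.zero_apply]
  have h1 := condExp_mul_of_stronglyMeasurable_left hZ hZD hD
  calc ∫ ω, Z ω * (P[g|F] ω - P[g|E] ω) ∂P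
      = ∫ ω, P[Z * (P[g|F] - P[g|E])|E] ω ∂P := (integral_condExp (hEF.trans hF)).symm
    _ = ∫ ω, (0 : ℝ) ∂P := by
        refine integral_congr_ae ?_
        filter_upwards [h0, h1] with ω h0 h1
        rw [h1, Pi.mul_apply, h0, Pi.zero_apply, mul_zero]
    _ = 0 := integral_zero _ _

theorem exists_integral_posPart_sub_lt {d : Ω → ℝ} (hd : Integrable d P) {ε : ℝ} (hε : 0 < ε) :
    ∃ r : ℕ, ∫ ω, max 0 (d ω - r) ∂P < ε := by
  have : Tendsto (fun r : ℕ => ∫ ω, max 0 (d ω - r) ∂P) atTop (𝓝 (∫ _, (0 : ℝ) ∂P)) := by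
    refine tendsto_integral_of_dominated_convergence (fun ω => |d ω|) (fun n => ?_) hd.abs
      (fun n => Eventually.of_forall fun ω => ?_) (Eventually.of_forall fun ω => ?_)
    · exact aestronglyMeasurable_const.sup
        (hd.aestronglyMeasurable.sub aestronglyMeasurable_const)
    · rw [Real.norm_eq_abs, abs_of_nonneg (le_max_left _ _)]
      exact max_le (abs_nonneg _)
        ((sub_le_self _ (Nat.cast_nonneg _)).trans (le_abs_self _))
    · obtain ⟨K, hK⟩ := exists_nat_ge (d ω)
      refine tendsto_const_nhds.congr' ?_
      filter_upwards [eventually_ge_atTop K] with n hn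
      have : (K : ℝ) ≤ n := by exact_mod_cast hn
      rw [max_eq_left (by linarith)]
  rw [integral_zero] at this
  exact (this.eventually_lt_const hε).exists

/-- The law of large numbers for the martingale differences `(P[f_k|F] - P[f_k|E]) ∘ T^k`, where
the σ-field `E ⊆ F` contains `T^k F` for all `k ≥ 1`. -/
theorem avgBound_condExp_sub_condExp {Ω : Type*} {E F : MeasurableSpace Ω}
    [mΩ : MeasurableSpace Ω] {P : Measure Ω} [IsProbabilityMeasure P] {T : Equiv.Perm Ω}
    (hT : Ergodic T P) (hEF : E ≤ F) (hF : F ≤ mΩ)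
    (hcomap : ∀ k : ℕ, F.comap (T.symm^[k + 1]) ≤ E) {f : ℕ → Ω → ℝ} {Λ : Ω → ℝ}
    (hΛ : Integrable Λ P) (hf : ∀ k, Measurable (f k)) (hfΛ : ∀ k ω, |f k ω| ≤ Λ ω)
    {ε : ℝ} (hε : 0 < ε) :
    AvgBound P (fun k ω => P[f k|F] (T^[k] ω) - P[f k|E] (T^[k] ω)) ε := by
  have hE : E ≤ mΩ := hEF.trans hF
  -- Truncation at level `r` changes `f k` by at most `d`; conditioning `d` on both `F` and `E`
  -- costs twice `ε / 4`, half of the allowance.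
  obtain ⟨r, hr⟩ := exists_integral_posPart_sub_lt hΛ (by positivity : 0 < ε / 4)
  set d : Ω → ℝ := fun ω => max 0 (Λ ω - r)
  have hd : Integrable d P := (integrable_zero _ _ _).sup (hΛ.sub (integrable_const _))
  set g : ℕ → Ω → ℝ := fun k ω => max (-r) (min r (f k ω))
  have hgb : ∀ k ω, |g k ω| ≤ r := fun k ω => by
    have : (0 : ℝ) ≤ r := Nat.cast_nonneg _
    exact abs_le.2 ⟨le_max_left _ _, max_le (by linarith) (min_le_left _ _)⟩
  have hfi : ∀ k, Integrable (f k) P := fun k =>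
    hΛ.mono' (hf k).aestronglyMeasurable (Eventually.of_forall (hfΛ k))
  have hgi : ∀ k, Integrable (g k) P := fun k =>
    Integrable.of_bound (measurable_const.max (measurable_const.min (hf k))).aestronglyMeasurable
      r (Eventually.of_forall (hgb k))
  have hfg : ∀ k ω, |f k ω - g k ω| ≤ d ω := fun k ω => by
    have h1 := abs_le.1 (hfΛ k ω)
    simp only [g, d]
    rw [abs_le]
    have : (0 : ℝ) ≤ r := Nat.cast_nonneg _
    constructor <;> rcases max_cases (0 : ℝ) (Λ ω - r) with h | h <;>
      rcases min_cases (r : ℝ) (f k ω) with h' | h' <;>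
      rcases max_cases (-(r : ℝ)) (min r (f k ω)) with h'' | h'' <;> linarith
  set D : ℕ → Ω → ℝ := fun k ω => P[g k|F] ω - P[g k|E] ω
  have hDm : ∀ k, StronglyMeasurable[F] (D k) := fun k =>
    stronglyMeasurable_condExp.sub (stronglyMeasurable_condExp.mono hEF)
  have hcb : ∀ (m : MeasurableSpace Ω) (k : ℕ), ∀ᵐ ω ∂P, |P[g k|m] ω| ≤ r := fun m k =>
    ae_bdd_abs_condExp_of_ae_bdd_abs (R := (r : ℝ)) (Eventually.of_forall (hgb k))
  have hDb : ∀ k, ∀ᵐ ω ∂P, |D k ω| ≤ 2 * r := fun k => by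
    filter_upwards [hcb F k, hcb E k] with ω h1 h2
    exact (abs_sub _ _).trans (by linarith)
  have hTk : ∀ k, MeasurePreserving (T^[k]) P P := fun k => hT.toMeasurePreserving.iterate k
  have hbdd : AvgBound P (fun k ω => D k (T^[k] ω)) (ε / 2) := by
    refine avgBound_of_orthogonal (C := 2 * r) (fun k => ?_) (fun k => ?_) (fun i k hik => ?_)
      (half_pos hε)
    · exact (((hDm k).mono hF).comp_measurable (hTk k).measurable).aestronglyMeasurable
    · exact (hTk k).quasiMeasurePreserving.ae (hDb k)
    -- Undoing the later shift `T^[i + j + 1]` turns the earlier difference into `Z`, which is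
    -- `E`-measurable by `hcomap`, hence orthogonal to `D (i + j + 1)`.
    · obtain ⟨j, rfl⟩ := Nat.exists_eq_add_of_lt hik
      set Z : Ω → ℝ := fun ω => D i (T.symm^[j + 1] ω)
      have hinv : ∀ ω, T.symm^[j + 1] (T^[i + j + 1] ω) = T^[i] ω := fun ω => by
        rw [show i + j + 1 = (j + 1) + i by ring, Function.iterate_add_apply T]
        exact (Function.LeftInverse.iterate T.symm_apply_apply (j + 1)) _
      have hZE : StronglyMeasurable[E] Z := by
        refine StronglyMeasurable.mono ?_ (hcomap j)
        exact (hDm i).comp_measurable (comap_measurable _)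
      have hZb : ∀ᵐ ω ∂P, |Z ω| ≤ 2 * r := by
        have h := (hTk (i + j + 1)).map_eq
        rw [← h, ae_map_iff (hTk _).measurable.aemeasurable]
        · simp only [Z, hinv]
          exact (hTk i).quasiMeasurePreserving.ae (hDb i)
        · exact measurableSet_le (hZE.mono hE).measurable.norm measurable_const
      have h0 := integral_mul_condExp_sub_condExp hEF hF (g := g (i + j + 1)) hZE hZb
      rw [← (hTk (i + j + 1)).map_eq, integral_map (hTk _).measurable.aemeasurable] at h0
      · simpa only [Z, hinv, (hTk (i + j + 1)).map_eq] using h0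
      · rw [(hTk (i + j + 1)).map_eq]
        exact ((hZE.mono hE).mul ((hDm (i + j + 1)).mono hF)).aestronglyMeasurable
  have htail : AvgBound P (fun k ω => (P[f k|F] (T^[k] ω) - P[f k|E] (T^[k] ω)) - D k (T^[k] ω))
      (ε / 2) := by
    refine avgBound_of_eventually_le (f := fun k ω => (P[f k|F] ω - P[f k|E] ω) - D k ω) hT
      (d := fun ω => P[d|F] ω + P[d|E] ω) (integrable_condExp.add integrable_condExp)
      (Eventually.of_forall fun k => abs_condExp_sub_condExp_le (hfi k) (hgi k) hd (hfg k)) ?_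
    rw [integral_add integrable_condExp integrable_condExp, integral_condExp hF,
      integral_condExp hE]
    linarith
  rw [← add_halves ε]
  refine (hbdd.add htail).congr fun k => Eventually.of_forall fun ω => ?_
  ring

end MartingaleDifferences

/-! ### Shifts of the observation σ-fields -/

section SigmaFields

variable {Ω : Type*} {T : Equiv.Perm Ω}

theorem pull_pull (m : MeasurableSpace Ω) (a b : ℤ) :
    pull T (pull T m b) a = pull T m (b + a) := by
  simp only [pull, MeasurableSpace.comap_comp, zpow_add, Equiv.Perm.coe_mul]

theorem pull_mono {m m' : MeasurableSpace Ω} (h : m ≤ m') (k : ℤ) : pull T m k ≤ pull T m' k :=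
  MeasurableSpace.comap_mono h

theorem pull_sup (m m' : MeasurableSpace Ω) (k : ℤ) :
    pull T (m ⊔ m') k = pull T m k ⊔ pull T m' k :=
  MeasurableSpace.comap_sup

theorem pull_monotone {X : MeasurableSpace Ω} (h : X ≤ pull T X 1) :
    Monotone fun k : ℤ => pull T X k :=
  monotone_int_of_le_succ fun k => by
    have := pull_mono (T := T) h k
    rwa [pull_pull, add_comm] at this

theorem obs_mono (Y : MeasurableSpace Ω) {S S' : Set ℤ} (h : S ⊆ S') : obs T Y S ≤ obs T Y S' :=
  biSup_mono h

theorem pull_obs_le (Y : MeasurableSpace Ω) {S S' : Set ℤ} {a : ℤ} (h : ∀ k ∈ S, k + a ∈ S') :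
    pull T (obs T Y S) a ≤ obs T Y S' := by
  simp only [obs]
  rw [pull, MeasurableSpace.comap_iSup]
  refine iSup_le fun k => ?_
  rw [MeasurableSpace.comap_iSup]
  refine iSup_le fun hk => ?_
  calc _ = pull T Y (k + a) := pull_pull Y a k
    _ ≤ _ := le_iSup₂_of_le (k + a) (h k hk) le_rfl

theorem measurable_comp_zpow {U : Type*} [MeasurableSpace U] {Y : MeasurableSpace Ω}
    {S S' : Set ℤ} {a : ℤ} {u : Ω → U} (hu : Measurable[obs T Y S] u)
    (h : ∀ k ∈ S, k + a ∈ S') : Measurable[obs T Y S'] fun ω => u ((T ^ a : Equiv.Perm Ω) ω) :=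
  (hu.comp (comap_measurable _)).mono (pull_obs_le Y h) le_rfl

theorem augmented_antitone (Y : MeasurableSpace Ω) {X : MeasurableSpace Ω} (h : X ≤ pull T X 1) :
    Antitone fun k : ℤ => augmented T Y X k := fun _ _ hab =>
  sup_le_sup le_rfl (pull_monotone h (neg_le_neg hab))

/-- A shift by `a ≤ -1` keeps past observations in the past and turns `T^j X` into `T^(j - a) X`,
which lies in `T^(j + 1) X` because `T^k X` decreases in `k`. -/
theorem pull_augmented_le (Y : MeasurableSpace Ω) {X : MeasurableSpace Ω} (h : X ≤ pull T X 1)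
    (j : ℤ) {a : ℤ} (ha : a ≤ -1) : pull T (augmented T Y X j) a ≤ augmented T Y X (j + 1) := by
  rw [augmented, pull_sup, pull_pull]
  refine sup_le_sup (pull_obs_le Y fun k hk => ?_) (pull_monotone h (by omega))
  simp only [Set.mem_Iic] at hk ⊢
  omega

theorem symm_iterate_eq_zpow (n : ℕ) : T.symm^[n] = ⇑(T ^ (-(n : ℤ)) : Equiv.Perm Ω) := by
  rw [Equiv.Perm.iterate_eq_pow, zpow_neg, zpow_natCast, ← inv_pow]
  rfl

theorem iterate_eq_zpow (n : ℕ) : T^[n] = ⇑(T ^ (n : ℤ) : Equiv.Perm Ω) := by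
  rw [Equiv.Perm.iterate_eq_pow, zpow_natCast]

theorem measurable_zpow [MeasurableSpace Ω] (hT : Measurable T) (hT' : Measurable T.symm) (k : ℤ) :
    Measurable (T ^ k : Equiv.Perm Ω) := by
  cases k with
  | ofNat n =>
    rw [Int.ofNat_eq_natCast, ← iterate_eq_zpow]
    exact hT.iterate n
  | negSucc n =>
    rw [Int.negSucc_eq, ← Nat.cast_succ, ← symm_iterate_eq_zpow]
    exact hT'.iterate _

theorem pull_le {m : MeasurableSpace Ω} [mΩ : MeasurableSpace Ω] (hm : m ≤ mΩ) (hT : Measurable T)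
    (hT' : Measurable T.symm) (k : ℤ) : pull T m k ≤ mΩ :=
  ((measurable_zpow hT hT' k).mono le_rfl hm).comap_le

theorem obs_le {Y : MeasurableSpace Ω} [mΩ : MeasurableSpace Ω] (hY : Y ≤ mΩ) (hT : Measurable T)
    (hT' : Measurable T.symm) (S : Set ℤ) : obs T Y S ≤ mΩ :=
  iSup₂_le fun k _ => pull_le hY hT hT' k

theorem augmented_le {Y X : MeasurableSpace Ω} [mΩ : MeasurableSpace Ω] (hY : Y ≤ mΩ)
    (hX : X ≤ mΩ) (hT : Measurable T) (hT' : Measurable T.symm) (k : ℤ) :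
    augmented T Y X k ≤ mΩ :=
  sup_le (obs_le hY hT hT' _) (pull_le hX hT hT' _)

theorem remote_le {Y X : MeasurableSpace Ω} [mΩ : MeasurableSpace Ω] (hY : Y ≤ mΩ)
    (hX : X ≤ mΩ) (hT : Measurable T) (hT' : Measurable T.symm) : remote T Y X ≤ mΩ :=
  (iInf₂_le 1 le_rfl).trans (augmented_le hY hX hT hT' _)

end SigmaFields

/-! ### Reduction to decisions at time zero, and the replacement of losses by conditional losses -/

section Loss

variable {Ω U : Type*} {T : Equiv.Perm Ω}

theorem loss_zero (ℓ : U → Ω → ℝ) (u : Ω → U) (ω : Ω) : loss ℓ T 0 u ω = ℓ (u ω) ω := by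
  simp [loss]

theorem loss_eq_comp (ℓ : U → Ω → ℝ) (k : ℕ) (u : Ω → U) (ω : Ω) :
    loss ℓ T k u ω =
      loss ℓ T 0 (fun ω => u ((T ^ (-(k : ℤ)) : Equiv.Perm Ω) ω)) (T^[k] ω) := by
  rw [loss_zero, loss, iterate_eq_zpow, ← Equiv.Perm.mul_apply, ← zpow_add]
  simp

theorem loss_comp_iterate (ℓ : U → Ω → ℝ) (k : ℕ) (w : Ω → U) (ω : Ω) :
    loss ℓ T k (fun ω => w ((T ^ (k : ℤ) : Equiv.Perm Ω) ω)) ω = loss ℓ T 0 w (T^[k] ω) := by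
  rw [loss_zero, loss, iterate_eq_zpow]

theorem measurable_of_mem_decisions [MeasurableSpace U] {Y : MeasurableSpace Ω}
    [mΩ : MeasurableSpace Ω] (hY : Y ≤ mΩ) (hT : Measurable T) (hT' : Measurable T.symm)
    {n : ℤ} {u : Ω → U} (hu : u ∈ decisions U T Y n) : Measurable u := by
  obtain ⟨m, -, hu⟩ := hu
  exact hu.mono (obs_le hY hT hT' _) le_rfl

theorem measurable_loss_zero [MeasurableSpace U] [MeasurableSpace Ω] {ℓ : U → Ω → ℝ}
    (hℓ : Measurable (Function.uncurry ℓ)) {u : Ω → U} (hu : Measurable u) :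
    Measurable (loss ℓ T 0 u) :=
  hℓ.comp (hu.prodMk measurable_id)

theorem abs_loss_zero_le {ℓ : U → Ω → ℝ} {Λ : Ω → ℝ} (hℓΛ : ∀ u ω, |ℓ u ω| ≤ Λ ω) (u : Ω → U)
    (ω : Ω) : |loss ℓ T 0 u ω| ≤ Λ ω :=
  hℓΛ _ _

theorem mem_decisions_of_measurable [MeasurableSpace U] {Y : MeasurableSpace Ω} {u : Ω → U} {n : ℕ}
    (hu : Measurable[obs T Y (Set.Icc (-(n : ℤ)) 0)] u) : u ∈ decisions U T Y 0 :=
  ⟨-n, by omega, hu⟩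

theorem Admissible.shift_mem_decisions [MeasurableSpace U] {Y : MeasurableSpace Ω}
    {u : ℕ → Ω → U} (hu : Admissible T Y u) {k : ℕ} (hk : 1 ≤ k) :
    (fun ω => u k ((T ^ (-(k : ℤ)) : Equiv.Perm Ω) ω)) ∈ decisions U T Y 0 :=
  mem_decisions_of_measurable (n := k) <| measurable_comp_zpow (hu k hk) fun j hj => by
    simp only [Set.mem_Icc] at hj ⊢
    omega

end Loss

theorem measurable_ereal_abs : Measurable EReal.abs :=
  EReal.measurable_of_measurable_real <| by
    simpa only [EReal.abs_def, Real.norm_eq_abs] using (measurable_norm (α := ℝ)).ennreal_ofReal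

/-- The essential supremum is a single majorant for all decisions; finite integral makes it a.s.
finite, so its real part serves as `d`. -/
theorem exists_dominating_of_uniformL1Dist_lt {Ω U : Type*} {Y : MeasurableSpace Ω}
    [MeasurableSpace Ω] [MeasurableSpace U] {P : Measure Ω} [IsFiniteMeasure P]
    {T : Equiv.Perm Ω} {F G : (Ω → U) → Ω → ℝ} {ε : ℝ}
    (h : uniformL1Dist Y P T F G < ENNReal.ofReal ε) :
    ∃ d : Ω → ℝ, Integrable d P ∧ ∫ ω, d ω ∂P < ε ∧
      ∀ u ∈ decisions U T Y 0, ∀ᵐ ω ∂P, |F u ω - G u ω| ≤ d ω := by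
  rw [uniformL1Dist] at h
  have H := isFamilyEssSup_familyEssSup P
    (fun (u : decisions U T Y 0) ω => ((|F u ω - G u ω| : ℝ) : EReal))
  set s := familyEssSup P
    (fun (u : decisions U T Y 0) ω => ((|F u ω - G u ω| : ℝ) : EReal))
  have hm : Measurable fun ω => (s ω).abs := measurable_ereal_abs.comp H.measurable
  have hfin := ae_lt_top hm (h.trans_le le_top).ne
  refine ⟨fun ω => (s ω).abs.toReal, integrable_toReal_of_lintegral_ne_top hm.aemeasurable
    (h.trans_le le_top).ne, ?_, fun u hu => ?_⟩
  · rw [integral_toReal hm.aemeasurable hfin]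
    exact (ENNReal.lt_ofReal_iff_toReal_lt (h.trans_le le_top).ne).1 h
  · filter_upwards [hfin, H.upper ⟨u, hu⟩] with ω h1 h2
    revert h1 h2
    generalize s ω = x
    induction x with
    | bot => simp
    | top => simp
    | coe r =>
      intro _ h2
      rw [EReal.abs_def, ENNReal.toReal_ofReal (abs_nonneg _)]
      exact (EReal.coe_le_coe_iff.1 h2).trans (le_abs_self r)

/-- Along any sequence of decisions, the losses and their conditional expectations given the remote
σ-field have asymptotically the same averages. -/
theorem avgBound_loss_sub_condExp_remote {Ω U : Type*} {Y X : MeasurableSpace Ω}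
    [mΩ : MeasurableSpace Ω] [MeasurableSpace U]
    {P : Measure Ω} [IsProbabilityMeasure P]
    {T : Equiv.Perm Ω} (hT : Ergodic T P) (hTinv : Measurable T.symm)
    (hY : Y ≤ mΩ) (hX : X ≤ mΩ)
    {ℓ : U → Ω → ℝ} (hℓ : Measurable (Function.uncurry ℓ))
    {Λ : Ω → ℝ} (hΛ : Integrable Λ P) (hℓΛ : ∀ u ω, |ℓ u ω| ≤ Λ ω)
    (h1 : X ≤ pull T X 1)
    (h2 : Tendsto (fun n : ℕ => uniformL1Dist (U := U) Y P T
        (fun u => P[loss ℓ T 0 u | augmented T Y X (-(n : ℤ))])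
        (fun u => loss ℓ T 0 u)) atTop (𝓝 0))
    (h2' : Tendsto (fun n : ℕ => uniformL1Dist (U := U) Y P T
        (fun u => P[loss ℓ T 0 u | augmented T Y X n])
        (fun u => P[loss ℓ T 0 u | remote T Y X])) atTop (𝓝 0))
    {w : ℕ → Ω → U} (hw : ∀ k, w k ∈ decisions U T Y 0) {ε : ℝ} (hε : 0 < ε) :
    AvgBound P (fun k ω => loss ℓ T 0 (w k) (T^[k] ω) -
      P[loss ℓ T 0 (w k) | remote T Y X] (T^[k] ω)) ε := by
  have hε3 : 0 < ENNReal.ofReal (ε / 3) := ENNReal.ofReal_pos.2 (by positivity)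
  obtain ⟨n, hn⟩ := (h2.eventually_lt_const hε3).exists
  obtain ⟨n', hn'⟩ := (h2'.eventually_lt_const hε3).exists
  obtain ⟨d, hd, hdε, hd'⟩ := exists_dominating_of_uniformL1Dist_lt hn
  obtain ⟨e, he, heε, he'⟩ := exists_dominating_of_uniformL1Dist_lt hn'
  have hfm : ∀ k, Measurable (loss ℓ T 0 (w k)) := fun k =>
    measurable_loss_zero hℓ (measurable_of_mem_decisions hY hT.measurable hTinv (hw k))
  have hA := avgBound_of_eventually_le hT hd
    (f := fun k ω => P[loss ℓ T 0 (w k) | augmented T Y X (-(n : ℤ))] ω - loss ℓ T 0 (w k) ω)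
    (Eventually.of_forall fun k => hd' _ (hw k)) hdε
  have hC := avgBound_of_eventually_le hT he
    (f := fun k ω => P[loss ℓ T 0 (w k) | augmented T Y X n'] ω -
      P[loss ℓ T 0 (w k) | remote T Y X] ω)
    (Eventually.of_forall fun k => he' _ (hw k)) heε
  have hA' : AvgBound P (fun k ω => loss ℓ T 0 (w k) (T^[k] ω) -
      P[loss ℓ T 0 (w k) | augmented T Y X (-(n : ℤ))] (T^[k] ω)) (ε / 3) := by
    filter_upwards [hA] with ω h
    filter_upwards [h] with N h
    rw [← abs_neg, ← Finset.sum_neg_distrib]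
    simpa only [neg_sub] using h
  -- One level at a time: a shift by one step is only guaranteed to gain one level, so a jump over
  -- several levels need not give martingale differences.
  have hstep : ∀ j : ℤ, ∀ δ > 0, AvgBound P
      (fun k ω => P[loss ℓ T 0 (w k) | augmented T Y X j] (T^[k] ω) -
        P[loss ℓ T 0 (w k) | augmented T Y X (j + 1)] (T^[k] ω)) δ := fun j δ hδ => by
    refine avgBound_condExp_sub_condExp hT (augmented_antitone Y h1 (by omega))
      (augmented_le hY hX hT.measurable hTinv j) (fun k => ?_) hΛ hfm
      (fun k => abs_loss_zero_le hℓΛ _) hδ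
    rw [symm_iterate_eq_zpow]
    exact pull_augmented_le Y h1 j (by push_cast; omega)
  have hB := AvgBound.sum (Finset.range (n + n'))
    (a := fun i k ω => P[loss ℓ T 0 (w k) | augmented T Y X (-(n : ℤ) + i)] (T^[k] ω) -
        P[loss ℓ T 0 (w k) | augmented T Y X (-(n : ℤ) + i + 1)] (T^[k] ω))
    (fun i _ => hstep _) (by positivity : 0 < ε / 3)
  have hB' : AvgBound P (fun k ω => P[loss ℓ T 0 (w k) | augmented T Y X (-(n : ℤ))] (T^[k] ω) -
      P[loss ℓ T 0 (w k) | augmented T Y X n'] (T^[k] ω)) (ε / 3) := by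
    refine hB.congr fun k => Eventually.of_forall fun ω => ?_
    have := Finset.sum_range_sub'
      (fun i : ℕ => P[loss ℓ T 0 (w k) | augmented T Y X (-(n : ℤ) + i)] (T^[k] ω)) (n + n')
    simp only [Nat.cast_add, Nat.cast_one, ← add_assoc, Nat.cast_zero, add_zero,
      neg_add_cancel, zero_add] at this
    exact this
  have hsum := (hA'.add hB').add hC
  rw [show ε / 3 + ε / 3 + ε / 3 = ε by ring] at hsum
  refine hsum.congr fun k => Eventually.of_forall fun ω => ?_
  ring

/-! ### Consequences of summable `L¹` errors -/

section Summable

variable {Ω : Type*} [MeasurableSpace Ω] {P : Measure Ω}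

theorem tsum_lintegral_ofReal_abs_ne_top {a : ℕ → Ω → ℝ} (ha : ∀ n, Integrable (a n) P)
    {b : ℕ → ℝ} (hb : Summable b) (hab : ∀ n, ∫ ω, |a n ω| ∂P ≤ b n) :
    ∑' n, ∫⁻ ω, ENNReal.ofReal |a n ω| ∂P ≠ ∞ := by
  refine ne_top_of_le_ne_top hb.tsum_ofReal_ne_top (ENNReal.tsum_le_tsum fun n => ?_)
  rw [← ofReal_integral_eq_lintegral_ofReal (ha n).abs (Eventually.of_forall fun _ => abs_nonneg _)]
  exact ENNReal.ofReal_le_ofReal (hab n)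

theorem aemeasurable_ofReal_abs {a : Ω → ℝ} (ha : Integrable a P) :
    AEMeasurable (fun ω => ENNReal.ofReal |a ω|) P :=
  ha.abs.aemeasurable.ennreal_ofReal

theorem ae_tendsto_zero_of_summable_integral {a : ℕ → Ω → ℝ} (ha : ∀ n, Integrable (a n) P)
    {b : ℕ → ℝ} (hb : Summable b) (hab : ∀ n, ∫ ω, |a n ω| ∂P ≤ b n) :
    ∀ᵐ ω ∂P, Tendsto (fun n => a n ω) atTop (𝓝 0) := by
  have hfin : ∀ᵐ ω ∂P, ∑' n, ENNReal.ofReal |a n ω| < ∞ := by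
    refine ae_lt_top' (AEMeasurable.tsum fun n => aemeasurable_ofReal_abs (ha n)) ?_
    rw [lintegral_tsum fun n => aemeasurable_ofReal_abs (ha n)]
    exact tsum_lintegral_ofReal_abs_ne_top ha hb hab
  filter_upwards [hfin] with ω hω
  have h := (ENNReal.tendsto_toReal ENNReal.zero_ne_top).comp
    (ENNReal.tendsto_atTop_zero_of_tsum_ne_top hω.ne)
  rw [tendsto_zero_iff_abs_tendsto_zero]
  simpa [Function.comp_def] using h

/-- The tail sum `∑_{n ≥ N} |a n|` majorizes all later terms, and its integral is the tail of a
convergent series. -/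
theorem exists_dominating_tail {a : ℕ → Ω → ℝ} (ha : ∀ n, Integrable (a n) P)
    {b : ℕ → ℝ} (hb : Summable b) (hab : ∀ n, ∫ ω, |a n ω| ∂P ≤ b n) {ε : ℝ} (hε : 0 < ε) :
    ∃ (N : ℕ) (d : Ω → ℝ), Integrable d P ∧ ∫ ω, d ω ∂P < ε ∧
      ∀ n, N ≤ n → ∀ᵐ ω ∂P, |a n ω| ≤ d ω := by
  have htail := ENNReal.tendsto_sum_nat_add (fun n => ∫⁻ ω, ENNReal.ofReal |a n ω| ∂P)
    (tsum_lintegral_ofReal_abs_ne_top ha hb hab)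
  obtain ⟨N, hN⟩ := (htail.eventually_lt_const (ENNReal.ofReal_pos.2 hε)).exists
  rw [← lintegral_tsum fun n => aemeasurable_ofReal_abs (ha _)] at hN
  have hm : AEMeasurable (fun ω => ∑' n, ENNReal.ofReal |a (n + N) ω|) P :=
    AEMeasurable.tsum fun n => aemeasurable_ofReal_abs (ha _)
  have hfin := ae_lt_top' hm (hN.trans_le le_top).ne
  refine ⟨N, fun ω => (∑' n, ENNReal.ofReal |a (n + N) ω|).toReal,
    integrable_toReal_of_lintegral_ne_top hm (hN.trans_le le_top).ne, ?_, fun n hn => ?_⟩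
  · rw [integral_toReal hm hfin]
    exact (ENNReal.lt_ofReal_iff_toReal_lt (hN.trans_le le_top).ne).1 hN
  · obtain ⟨j, rfl⟩ := Nat.exists_eq_add_of_le' hn
    filter_upwards [hfin] with ω hω
    rw [← ENNReal.toReal_ofReal (abs_nonneg (a (j + N) ω))]
    exact ENNReal.toReal_mono hω.ne (ENNReal.le_tsum (f := fun n => ENNReal.ofReal |a (n + N) ω|) j)

theorem tendsto_setIntegral_of_symmDiff {f : Ω → ℝ} (hf : Integrable f P) {A : ℕ → Set Ω}
    {B : Set Ω} (hA : ∀ n, MeasurableSet (A n)) (hB : MeasurableSet B)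
    (h : Tendsto (fun n => P (symmDiff (A n) B)) atTop (𝓝 0)) :
    Tendsto (fun n => ∫ ω in A n, f ω ∂P) atTop (𝓝 (∫ ω in B, f ω ∂P)) := by
  rw [tendsto_iff_dist_tendsto_zero]
  have h0 := hf.abs.tendsto_setIntegral_nhds_zero (s := fun n => symmDiff (A n) B) h
  refine squeeze_zero (fun _ => dist_nonneg) (fun n => ?_) h0
  rw [Real.dist_eq, ← integral_indicator (hA n), ← integral_indicator hB,
    ← integral_indicator ((hA n).symmDiff hB),
    ← integral_sub (hf.indicator (hA n)) (hf.indicator hB)]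
  refine (abs_integral_le_integral_abs).trans (le_of_eq (integral_congr_ae ?_))
  refine Eventually.of_forall fun ω => ?_
  by_cases h1 : ω ∈ A n <;> by_cases h2 : ω ∈ B <;> simp [Set.mem_symmDiff, h1, h2]

end Summable

/-! ### Switching between decisions on events of the infinite past -/

section Selection

variable {Ω U : Type*} {T : Equiv.Perm Ω} {Y : MeasurableSpace Ω}

theorem obs_Iic_eq_generateFrom (T : Equiv.Perm Ω) (Y : MeasurableSpace Ω) :
    obs T Y (Set.Iic 0) = MeasurableSpace.generateFrom
      {s | ∃ n : ℕ, MeasurableSet[obs T Y (Set.Icc (-(n : ℤ)) 0)] s} := by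
  rw [← MeasurableSpace.measurableSpace_iSup_eq fun n : ℕ => obs T Y (Set.Icc (-(n : ℤ)) 0)]
  refine le_antisymm (iSup₂_le fun k hk => ?_)
    (iSup_le fun n => obs_mono Y Set.Icc_subset_Iic_self)
  refine le_iSup_of_le k.natAbs (le_iSup₂_of_le k ?_ le_rfl)
  simp only [Set.mem_Iic, Set.mem_Icc] at hk ⊢
  omega

/-- Events seen in finitely many observations form a ring generating the σ-field of the infinite
past, hence are dense in measure. -/
theorem exists_finite_obs_approx [mΩ : MeasurableSpace Ω] {P : Measure Ω} [IsFiniteMeasure P]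
    (hY : obs T Y (Set.Iic 0) ≤ mΩ) {B : Set Ω} (hB : MeasurableSet[obs T Y (Set.Iic 0)] B)
    {ε : ℝ≥0∞} (hε : 0 < ε) :
    ∃ (n : ℕ) (A : Set Ω), MeasurableSet[obs T Y (Set.Icc (-(n : ℤ)) 0)] A ∧
      P (symmDiff A B) < ε := by
  have hmono : ∀ {n n' : ℕ} {s : Set Ω}, n ≤ n' →
      MeasurableSet[obs T Y (Set.Icc (-(n : ℤ)) 0)] s →
      MeasurableSet[obs T Y (Set.Icc (-(n' : ℤ)) 0)] s := fun h hs =>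
    obs_mono Y (Set.Icc_subset_Icc_left (by omega)) _ hs
  obtain ⟨A, ⟨n, hA⟩, hlt⟩ := @exists_measure_symmDiff_lt_of_generateFrom_isSetRing Ω
    (obs T Y (Set.Iic 0)) (P.trim hY) _
    {s | ∃ n : ℕ, MeasurableSet[obs T Y (Set.Icc (-(n : ℤ)) 0)] s}
    { empty_mem := ⟨0, @MeasurableSet.empty _ (_)⟩
      union_mem := fun s t ⟨n, hs⟩ ⟨n', ht⟩ => ⟨max n n',
        (hmono (le_max_left _ _) hs).union (hmono (le_max_right _ _) ht)⟩
      sdiff_mem := fun s t ⟨n, hs⟩ ⟨n', ht⟩ => ⟨max n n',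
        (hmono (le_max_left _ _) hs).diff (hmono (le_max_right _ _) ht)⟩ }
    ⟨{Set.univ}, Set.countable_singleton _, by
      rintro _ rfl
      exact ⟨0, @MeasurableSet.univ _ (_)⟩, by simp⟩
    (obs_Iic_eq_generateFrom T Y) B hB ε hε
  refine ⟨n, A, hA, ?_⟩
  rwa [trim_measurableSet_eq hY] at hlt
  exact MeasurableSet.symmDiff (obs_mono Y Set.Icc_subset_Iic_self _ hA) hB

variable [mU : MeasurableSpace U]

open Classical in
theorem piecewise_mem_decisions {A : Set Ω} {n : ℕ}
    (hA : MeasurableSet[obs T Y (Set.Icc (-(n : ℤ)) 0)] A) {u v : Ω → U}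
    (hu : u ∈ decisions U T Y 0) (hv : v ∈ decisions U T Y 0) :
    A.piecewise u v ∈ decisions U T Y 0 := by
  obtain ⟨m, hm, hu⟩ := hu
  obtain ⟨m', hm', hv⟩ := hv
  refine ⟨min (-(n : ℤ)) (min m m'), by omega, ?_⟩
  exact Measurable.piecewise (obs_mono Y (Set.Icc_subset_Icc_left (by omega)) _ hA)
    (hu.mono (obs_mono Y (Set.Icc_subset_Icc_left (by omega))) le_rfl)
    (hv.mono (obs_mono Y (Set.Icc_subset_Icc_left (by omega))) le_rfl)

theorem const_mem_decisions (x : U) : (fun _ : Ω => x) ∈ decisions U T Y 0 :=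
  ⟨0, le_rfl, measurable_const⟩

variable [mΩ : MeasurableSpace Ω] {P : Measure Ω}

theorem integrable_loss_zero (hY : Y ≤ mΩ) (hT : Measurable T) (hT' : Measurable T.symm)
    {ℓ : U → Ω → ℝ} (hℓ : Measurable (Function.uncurry ℓ))
    {Λ : Ω → ℝ} (hΛ : Integrable Λ P) (hℓΛ : ∀ u ω, |ℓ u ω| ≤ Λ ω) {u : Ω → U}
    (hu : u ∈ decisions U T Y 0) : Integrable (loss ℓ T 0 u) P :=
  hΛ.mono' (measurable_loss_zero hℓ
    (measurable_of_mem_decisions hY hT hT' hu)).aestronglyMeasurable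
    (Eventually.of_forall (abs_loss_zero_le hℓΛ u))

-- The minimum is the conditional loss of playing `u` where it is no worse than `v`, and `v`
-- elsewhere. That event needs the infinite past, so it is approximated by finite-past events, on
-- which switching stays within the allowed decisions.
open Classical in
theorem le_integral_min_condExp [IsProbabilityMeasure P] (hY : Y ≤ mΩ) (hT : Measurable T) (hT' : Measurable T.symm)
    {ℓ : U → Ω → ℝ} (hℓ : Measurable (Function.uncurry ℓ))
    {Λ : Ω → ℝ} (hΛ : Integrable Λ P) (hℓΛ : ∀ u ω, |ℓ u ω| ≤ Λ ω) {c : ℝ}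
    (hc : ∀ w ∈ decisions U T Y 0, c ≤ ∫ ω, loss ℓ T 0 w ω ∂P) {u v : Ω → U}
    (hu : u ∈ decisions U T Y 0) (hv : v ∈ decisions U T Y 0) :
    c ≤ ∫ ω, min (P[loss ℓ T 0 u | obs T Y (Set.Iic 0)] ω)
      (P[loss ℓ T 0 v | obs T Y (Set.Iic 0)] ω) ∂P := by
  have hF : obs T Y (Set.Iic 0) ≤ mΩ := obs_le hY hT hT' _
  have hui := integrable_loss_zero hY hT hT' hℓ hΛ hℓΛ hu
  have hvi := integrable_loss_zero hY hT hT' hℓ hΛ hℓΛ hv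
  set B : Set Ω := {ω | P[loss ℓ T 0 u | obs T Y (Set.Iic 0)] ω ≤ P[loss ℓ T 0 v | obs T Y (Set.Iic 0)] ω}
  have hB : MeasurableSet[obs T Y (Set.Iic 0)] B := @measurableSet_le _ _ _ _ _ (obs T Y (Set.Iic 0)) _ _ _ _ _
    stronglyMeasurable_condExp.measurable stronglyMeasurable_condExp.measurable
  choose N A hA hAB using fun n : ℕ => exists_finite_obs_approx (P := P) hF hB
    (ε := ((n : ℝ≥0∞) + 1)⁻¹) (by simp)
  have hAm : ∀ n, MeasurableSet (A n) := fun n =>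
    obs_le hY hT hT' _ _ (hA n)
  have hlim : Tendsto (fun n => P (symmDiff (A n) B)) atTop (𝓝 0) := by
    refine tendsto_of_tendsto_of_tendsto_of_le_of_le tendsto_const_nhds ?_ (fun _ => zero_le)
      (fun n => (hAB n).le)
    have := (tendsto_add_atTop_iff_nat 1).2 ENNReal.tendsto_inv_nat_nhds_zero
    simpa using this
  have hmin : ∫ ω, min (P[loss ℓ T 0 u | obs T Y (Set.Iic 0)] ω) (P[loss ℓ T 0 v | obs T Y (Set.Iic 0)] ω) ∂P =
      ∫ ω in B, (loss ℓ T 0 u - loss ℓ T 0 v) ω ∂P + ∫ ω, loss ℓ T 0 v ω ∂P := by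
    rw [← setIntegral_condExp hF (hui.sub hvi) hB, ← integral_condExp hF (f := loss ℓ T 0 v),
      ← integral_indicator (hF _ hB),
      ← integral_add (integrable_condExp.indicator (hF _ hB)) integrable_condExp]
    refine integral_congr_ae ?_
    filter_upwards [condExp_sub hui hvi (obs T Y (Set.Iic 0))] with ω hω
    by_cases h : ω ∈ B
    · rw [Set.indicator_of_mem h, hω, min_eq_left h]
      simp
    · rw [Set.indicator_of_notMem h, min_eq_right (not_le.1 h).le, zero_add]
  rw [hmin]
  refine ge_of_tendsto' ((tendsto_setIntegral_of_symmDiff (hui.sub hvi) hAm (hF _ hB)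
    hlim).add_const _) fun n => ?_
  refine (hc _ (piecewise_mem_decisions (hA n) hu hv)).trans (le_of_eq ?_)
  rw [← integral_indicator (hAm n), ← integral_add ((hui.sub hvi).indicator (hAm n)) hvi]
  refine integral_congr_ae (Eventually.of_forall fun ω => ?_)
  by_cases h : ω ∈ A n <;> simp [loss_zero, h]

end Selection

/-! ### The minimal conditional loss and minimizing decisions -/

section InfLoss

/-- The minimal conditional loss `ess inf_u E[ℓ_0(u) | m]`, as a real function. -/
noncomputable def infLoss {Ω U : Type*} (Y m : MeasurableSpace Ω) [MeasurableSpace Ω]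
    [MeasurableSpace U] (P : Measure Ω) [IsFiniteMeasure P] (T : Equiv.Perm Ω)
    (ℓ : U → Ω → ℝ) (ω : Ω) : ℝ :=
  (familyEssInf P
    (fun (u : decisions U T Y 0) ω => ((P[loss ℓ T 0 u | m] ω : ℝ) : EReal)) ω).toReal

variable {Ω U : Type*} {T : Equiv.Perm Ω} {Y m : MeasurableSpace Ω} [MeasurableSpace U]
  [mΩ : MeasurableSpace Ω] {P : Measure Ω} {ℓ : U → Ω → ℝ} {Λ : Ω → ℝ}

theorem abs_condExp_loss_le (hY : Y ≤ mΩ) (hT : Measurable T) (hT' : Measurable T.symm)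
    (hℓ : Measurable (Function.uncurry ℓ)) (hΛ : Integrable Λ P) (hℓΛ : ∀ u ω, |ℓ u ω| ≤ Λ ω)
    {u : Ω → U} (hu : u ∈ decisions U T Y 0) :
    ∀ᵐ ω ∂P, |P[loss ℓ T 0 u | m] ω| ≤ P[Λ | m] ω :=
  abs_condExp_le_condExp (integrable_loss_zero hY hT hT' hℓ hΛ hℓΛ hu) hΛ
    (Eventually.of_forall (abs_loss_zero_le hℓΛ u))

variable [IsProbabilityMeasure P]

/-- The lower bound `-P[Λ | m]` and the loss of one constant decision make the essential infimum
finite a.s., so `toReal` loses nothing. -/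
theorem coe_infLoss [Nonempty U] (hm : m ≤ mΩ) (hY : Y ≤ mΩ) (hT : Measurable T)
    (hT' : Measurable T.symm)
    (hℓ : Measurable (Function.uncurry ℓ)) (hΛ : Integrable Λ P) (hℓΛ : ∀ u ω, |ℓ u ω| ≤ Λ ω) :
    ∀ᵐ ω ∂P, |infLoss Y m P T ℓ ω| ≤ P[Λ | m] ω ∧ (infLoss Y m P T ℓ ω : EReal) =
      familyEssInf P
        (fun (u : decisions U T Y 0) ω => ((P[loss ℓ T 0 u | m] ω : ℝ) : EReal)) ω := by
  obtain ⟨x⟩ := ‹Nonempty U›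
  have hx : (fun _ : Ω => x) ∈ decisions U T Y 0 := const_mem_decisions x
  have H := isFamilyEssInf_familyEssInf P
    (fun (u : decisions U T Y 0) ω => ((P[loss ℓ T 0 u | m] ω : ℝ) : EReal))
  have hlow := H.greatest (fun ω => ((-P[Λ | m] ω : ℝ) : EReal))
    ((stronglyMeasurable_condExp.mono hm).measurable.neg.coe_real_ereal) fun u => by
      filter_upwards [abs_condExp_loss_le (m := m) hY hT hT' hℓ hΛ hℓΛ u.2] with ω hω
      exact EReal.coe_le_coe_iff.2 (abs_le.1 hω).1
  filter_upwards [hlow, H.lower ⟨_, hx⟩,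
    abs_condExp_loss_le (m := m) hY hT hT' hℓ hΛ hℓΛ hx] with ω h1 h2 h3
  have h4 : (infLoss Y m P T ℓ ω : EReal) = familyEssInf P
      (fun (u : decisions U T Y 0) ω => ((P[loss ℓ T 0 u | m] ω : ℝ) : EReal)) ω :=
    EReal.coe_toReal (ne_top_of_le_ne_top (EReal.coe_ne_top _) h2)
      (ne_bot_of_le_ne_bot (EReal.coe_ne_bot _) h1)
  refine ⟨?_, h4⟩
  rw [← h4, EReal.coe_le_coe_iff] at h1 h2
  exact abs_le.2 ⟨h1, h2.trans (abs_le.1 h3).2⟩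

theorem measurable_infLoss : Measurable (infLoss Y m P T ℓ) :=
  (isFamilyEssInf_familyEssInf P _).measurable.ereal_toReal

theorem integrable_infLoss [Nonempty U] (hm : m ≤ mΩ) (hY : Y ≤ mΩ) (hT : Measurable T)
    (hT' : Measurable T.symm)
    (hℓ : Measurable (Function.uncurry ℓ)) (hΛ : Integrable Λ P) (hℓΛ : ∀ u ω, |ℓ u ω| ≤ Λ ω) :
    Integrable (infLoss Y m P T ℓ) P :=
  integrable_condExp.mono' measurable_infLoss.aestronglyMeasurable
    ((coe_infLoss hm hY hT hT' hℓ hΛ hℓΛ).mono fun _ h => h.1)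

theorem infLoss_le_condExp [Nonempty U] (hm : m ≤ mΩ) (hY : Y ≤ mΩ) (hT : Measurable T)
    (hT' : Measurable T.symm)
    (hℓ : Measurable (Function.uncurry ℓ)) (hΛ : Integrable Λ P) (hℓΛ : ∀ u ω, |ℓ u ω| ≤ Λ ω)
    {u : Ω → U} (hu : u ∈ decisions U T Y 0) :
    infLoss Y m P T ℓ ≤ᵐ[P] P[loss ℓ T 0 u | m] := by
  filter_upwards [coe_infLoss hm hY hT hT' hℓ hΛ hℓΛ, (isFamilyEssInf_familyEssInf P
    (fun (u : decisions U T Y 0) ω => ((P[loss ℓ T 0 u | m] ω : ℝ) : EReal))).lower ⟨u, hu⟩]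
    with ω h1 h2
  rw [← h1.2] at h2
  exact EReal.coe_le_coe_iff.1 h2

/-- There are decisions depending on finitely many observations whose expected losses
converge to `L⋆`. -/
theorem exists_integral_loss_le_Lstar_add [Nonempty U] (hY : Y ≤ mΩ) (hT : Measurable T)
    (hT' : Measurable T.symm)
    (hℓ : Measurable (Function.uncurry ℓ)) (hΛ : Integrable Λ P) (hℓΛ : ∀ u ω, |ℓ u ω| ≤ Λ ω) :
    ∃ w : ℕ → Ω → U, (∀ n, w n ∈ decisions U T Y 0) ∧
      ∀ n, ∫ ω, loss ℓ T 0 (w n) ω ∂P ≤ Lstar Y P T ℓ + (1 / 2) ^ n := by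
  obtain ⟨x⟩ := id ‹Nonempty U›
  have hF : obs T Y (Set.Iic 0) ≤ mΩ := obs_le hY hT hT' _
  set c : ℝ := ⨅ u : decisions U T Y 0, ∫ ω, loss ℓ T 0 u ω ∂P with hc_def
  have hbdd : BddBelow (Set.range fun u : decisions U T Y 0 => ∫ ω, loss ℓ T 0 u ω ∂P) := by
    refine ⟨∫ ω, -Λ ω ∂P, ?_⟩
    rintro _ ⟨u, rfl⟩
    exact integral_mono hΛ.neg (integrable_loss_zero hY hT hT' hℓ hΛ hℓΛ u.2)
      fun ω => (abs_le.1 (abs_loss_zero_le hℓΛ _ ω)).1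
  have hc : ∀ w ∈ decisions U T Y 0, c ≤ ∫ ω, loss ℓ T 0 w ω ∂P := fun w hw =>
    ciInf_le hbdd ⟨w, hw⟩
  have : Nonempty (decisions U T Y 0) := ⟨⟨_, const_mem_decisions x⟩⟩
  have hex : ∀ n : ℕ, ∃ u : decisions U T Y 0,
      ∫ ω, loss ℓ T 0 u ω ∂P < c + (1 / 2) ^ n := fun n =>
    exists_lt_of_ciInf_lt (lt_add_of_pos_right c (by positivity))
  choose w hw using hex
  refine ⟨fun n => w n, fun n => (w n).2, fun n => ?_⟩
  -- Conditioning gains nothing: `L⋆` is the infimum of the unconditional expected losses.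
  suffices h : Lstar Y P T ℓ = c by rw [h]; exact (hw n).le
  have hHi : ∀ u : Ω → U, Integrable (P[loss ℓ T 0 u | obs T Y (Set.Iic 0)]) P :=
    fun _ => integrable_condExp
  -- The difference is nonnegative with integral at most `(c + 2⁻ⁿ) - c`, by
  -- `le_integral_min_condExp`; summability gives a.s. convergence without a subsequence.
  have hconv : ∀ v : decisions U T Y 0, ∀ᵐ ω ∂P, Tendsto (fun n =>
      P[loss ℓ T 0 (w n) | obs T Y (Set.Iic 0)] ω -
        min (P[loss ℓ T 0 (w n) | obs T Y (Set.Iic 0)] ω)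
          (P[loss ℓ T 0 v | obs T Y (Set.Iic 0)] ω)) atTop (𝓝 0) := fun v => by
    have hmi : ∀ n, Integrable (fun ω => min (P[loss ℓ T 0 (w n) | obs T Y (Set.Iic 0)] ω)
        (P[loss ℓ T 0 v | obs T Y (Set.Iic 0)] ω)) P := fun n => (hHi _).inf (hHi _)
    refine ae_tendsto_zero_of_summable_integral (fun n => (hHi _).sub (hmi n))
      (summable_geometric_of_lt_one (by norm_num : (0 : ℝ) ≤ 1 / 2) (by norm_num)) fun n => ?_
    have habs : ∀ ω, |P[loss ℓ T 0 (w n) | obs T Y (Set.Iic 0)] ω -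
        min (P[loss ℓ T 0 (w n) | obs T Y (Set.Iic 0)] ω)
          (P[loss ℓ T 0 v | obs T Y (Set.Iic 0)] ω)| =
        P[loss ℓ T 0 (w n) | obs T Y (Set.Iic 0)] ω -
        min (P[loss ℓ T 0 (w n) | obs T Y (Set.Iic 0)] ω)
          (P[loss ℓ T 0 v | obs T Y (Set.Iic 0)] ω) := fun ω =>
      abs_of_nonneg (sub_nonneg.2 (min_le_left _ _))
    simp only [habs]
    rw [integral_sub (hHi _) (hmi n), integral_condExp hF]
    linarith [le_integral_min_condExp hY hT hT' hℓ hΛ hℓΛ hc (w n).2 v.2, hw n]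
  -- By `hconv` the limsup along `w` lies a.s. below the conditional loss of each `v`, hence below
  -- the essential infimum.
  have hlimsup := (isFamilyEssInf_familyEssInf P (fun (u : decisions U T Y 0) ω =>
      ((P[loss ℓ T 0 u | obs T Y (Set.Iic 0)] ω : ℝ) : EReal))).greatest
    (fun ω => limsup (fun n =>
      ((P[loss ℓ T 0 (w n) | obs T Y (Set.Iic 0)] ω : ℝ) : EReal)) atTop)
    (Measurable.limsup fun n =>
      (stronglyMeasurable_condExp.mono hF).measurable.coe_real_ereal) fun v => by
      filter_upwards [hconv v] with ω hω
      have h1 : Tendsto (fun n => (((P[loss ℓ T 0 v | obs T Y (Set.Iic 0)] ω +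
          (P[loss ℓ T 0 (w n) | obs T Y (Set.Iic 0)] ω -
            min (P[loss ℓ T 0 (w n) | obs T Y (Set.Iic 0)] ω)
              (P[loss ℓ T 0 v | obs T Y (Set.Iic 0)] ω)) : ℝ)) : EReal)) atTop
          (𝓝 ((P[loss ℓ T 0 v | obs T Y (Set.Iic 0)] ω : ℝ) : EReal)) := by
        refine (continuous_coe_real_ereal.tendsto _).comp ?_
        simpa using hω.const_add (P[loss ℓ T 0 v | obs T Y (Set.Iic 0)] ω)
      rw [← h1.limsup_eq]
      refine limsup_le_limsup (Eventually.of_forall fun n => EReal.coe_le_coe_iff.2 ?_)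
      linarith [min_le_right (P[loss ℓ T 0 (w n) | obs T Y (Set.Iic 0)] ω)
        (P[loss ℓ T 0 v | obs T Y (Set.Iic 0)] ω)]
  have hpt : ∀ᵐ ω ∂P, Tendsto (fun n => P[loss ℓ T 0 (w n) | obs T Y (Set.Iic 0)] ω) atTop
      (𝓝 (infLoss Y (obs T Y (Set.Iic 0)) P T ℓ ω)) := by
    filter_upwards [hlimsup, coe_infLoss hF hY hT hT' hℓ hΛ hℓΛ,
      ae_all_iff.2 fun n => infLoss_le_condExp hF hY hT hT' hℓ hΛ hℓΛ (w n).2] with ω h1 h2 h3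
    rw [← h2.2] at h1
    rw [← EReal.tendsto_coe]
    exact tendsto_of_le_liminf_of_limsup_le
      (le_liminf_of_le (by isBoundedDefault)
        (Eventually.of_forall fun n => EReal.coe_le_coe_iff.2 (h3 n))) h1
  have hlim1 : Tendsto (fun n => ∫ ω, P[loss ℓ T 0 (w n) | obs T Y (Set.Iic 0)] ω ∂P) atTop
      (𝓝 (Lstar Y P T ℓ)) :=
    tendsto_integral_of_dominated_convergence (P[Λ | obs T Y (Set.Iic 0)])
      (fun n => (hHi _).aestronglyMeasurable) integrable_condExp
      (fun n => abs_condExp_loss_le hY hT hT' hℓ hΛ hℓΛ (w n).2) hpt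
  simp only [integral_condExp hF] at hlim1
  refine tendsto_nhds_unique hlim1 ?_
  refine tendsto_of_tendsto_of_tendsto_of_le_of_le tendsto_const_nhds ?_
    (fun n => hc _ (w n).2) fun n => (hw n).le
  simpa using (tendsto_pow_atTop_nhds_zero_of_lt_one (by norm_num : (0 : ℝ) ≤ 1 / 2)
    (by norm_num)).const_add c

end InfLoss

/-! ### From decisions at time zero to admissible strategies -/

section Strategy

variable {Ω U : Type*} {T : Equiv.Perm Ω} {Y : MeasurableSpace Ω} [MeasurableSpace U]

/-- A sequence of decisions can be slowed down so that the `k`-th one depends on the last `k + 1`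
observations only. -/
theorem exists_slow_decisions [Nonempty U] {w : ℕ → Ω → U}
    (hw : ∀ n, w n ∈ decisions U T Y 0) :
    ∃ v : ℕ → Ω → U, (∀ k : ℕ, Measurable[obs T Y (Set.Icc (-(k : ℤ)) 0)] (v k)) ∧
      ∀ N, ∀ᶠ k in atTop, ∃ n, N ≤ n ∧ v k = w n := by
  classical
  obtain ⟨x⟩ := ‹Nonempty U›
  have hex : ∀ n, ∃ M : ℕ, Measurable[obs T Y (Set.Icc (-(M : ℤ)) 0)] (w n) := fun n => by
    obtain ⟨m, hm, h⟩ := hw n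
    exact ⟨m.natAbs, h.mono (obs_mono Y (Set.Icc_subset_Icc_left (by omega))) le_rfl⟩
  choose M hM using hex
  -- The largest `n ≤ k` whose decision `w n` needs no more than the window available at time `k`.
  -- `Nat.findGreatest` returns `0` when there is none, whence the constant fallback below.
  set ν : ℕ → ℕ := fun k => Nat.findGreatest (fun n => M n ≤ k) k
  refine ⟨fun k => if M (ν k) ≤ k then w (ν k) else fun _ => x, fun k => ?_, fun N => ?_⟩
  · by_cases h : M (ν k) ≤ k
    · simp only [if_pos h]
      exact (hM _).mono (obs_mono Y (Set.Icc_subset_Icc_left (by omega))) le_rfl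
    · simp only [if_neg h]
      exact measurable_const
  · filter_upwards [eventually_ge_atTop (max N (M N))] with k hk
    have h1 : N ≤ k := (le_max_left _ _).trans hk
    have h2 : M N ≤ k := (le_max_right _ _).trans hk
    exact ⟨ν k, Nat.le_findGreatest h1 h2,
      if_pos (Nat.findGreatest_spec (P := fun n => M n ≤ k) h1 h2)⟩

theorem admissible_of_measurable {v : ℕ → Ω → U}
    (hv : ∀ k : ℕ, Measurable[obs T Y (Set.Icc (-(k : ℤ)) 0)] (v k)) :
    Admissible T Y fun k ω => v k ((T ^ (k : ℤ) : Equiv.Perm Ω) ω) := fun k _ =>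
  measurable_comp_zpow (hv k) fun j hj => by
    simp only [Set.mem_Icc] at hj ⊢
    omega

end Strategy

theorem tendsto_avg_iterate {Ω : Type*} [MeasurableSpace Ω] {P : Measure Ω}
    [IsProbabilityMeasure P] {T : Ω → Ω} (hT : Ergodic T P) {f : Ω → ℝ} (hf : Integrable f P) :
    ∀ᵐ ω ∂P, Tendsto (fun N : ℕ => (1 / (N : ℝ)) * ∑ k ∈ Finset.Icc 1 N, f (T^[k] ω)) atTop
      (𝓝 (∫ ω, f ω ∂P)) := by
  have h : ∀ ε > 0, AvgBound P (fun k ω => f (T^[k] ω) - ∫ ω, f ω ∂P) ε := fun ε hε => by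
    have hi : Integrable (fun ω => f ω - ∫ ω, f ω ∂P) P := hf.sub (integrable_const _)
    have hi0 : ∫ ω, (f ω - ∫ ω, f ω ∂P) ∂P = 0 := by
      rw [integral_sub hf (integrable_const _)]
      simp
    filter_upwards [ae_eventually_sum_Icc_le hT hi (a := ε) (by rwa [hi0]),
      ae_eventually_sum_Icc_le hT hi.neg (a := ε) (by
        simpa only [Pi.neg_apply, integral_neg, hi0, neg_zero] using hε)] with ω h1 h2
    filter_upwards [h1, h2] with N h1 h2
    simp only [Pi.neg_apply, Finset.sum_neg_distrib] at h2
    exact abs_le.2 ⟨by linarith, h1⟩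
  filter_upwards [tendsto_avg_of_avgBound h] with ω hω
  have h2 := hω.add_const (∫ ω, f ω ∂P)
  rw [zero_add] at h2
  refine h2.congr' ?_
  filter_upwards [eventually_ge_atTop 1] with N hN
  have : (N : ℝ) ≠ 0 := by positivity
  simp only [Finset.sum_sub_distrib, Finset.sum_const, Nat.card_Icc, Nat.add_sub_cancel,
    nsmul_eq_mul]
  field_simp
  ring

end SeqDecision

/-! ### Pathwise optimality -/

open SeqDecision in
theorem mainTheorem1 {Ω U : Type*} (Y X : MeasurableSpace Ω) [mΩ : MeasurableSpace Ω]
    [MeasurableSpace U] [Nonempty U]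
    (P : Measure Ω) [IsProbabilityMeasure P]
    (T : Equiv.Perm Ω) (hT : Ergodic T P) (hTinv : Measurable T.symm)
    (hY : Y ≤ mΩ) (hX : X ≤ mΩ)
    (ℓ : U → Ω → ℝ) (hℓ : Measurable (Function.uncurry ℓ))
    (Λ : Ω → ℝ) (hΛ : Integrable Λ P) (hℓΛ : ∀ u ω, |ℓ u ω| ≤ Λ ω)
    (h1 : X ≤ SeqDecision.pull T X 1)
    (h2 : Tendsto (fun n : ℕ => SeqDecision.uniformL1Dist (U := U) Y P T
        (fun u => P[SeqDecision.loss ℓ T 0 u | SeqDecision.augmented T Y X (-(n : ℤ))])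
        (fun u => SeqDecision.loss ℓ T 0 u)) atTop (𝓝 0))
    (h2' : Tendsto (fun n : ℕ => SeqDecision.uniformL1Dist (U := U) Y P T
        (fun u => P[SeqDecision.loss ℓ T 0 u | SeqDecision.augmented T Y X n])
        (fun u => P[SeqDecision.loss ℓ T 0 u | SeqDecision.remote T Y X])) atTop (𝓝 0))
    (h3 : SeqDecision.Lstar Y P T ℓ =
      SeqDecision.expectedInfLoss Y (SeqDecision.remote T Y X) P T ℓ) :
    ∃ ustar : ℕ → Ω → U, SeqDecision.PathwiseOptimal Y P T ℓ ustar ∧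
      ∀ᵐ ω ∂P, Tendsto (fun N : ℕ => SeqDecision.avgLoss ℓ T ustar N ω) atTop
        (𝓝 (SeqDecision.Lstar Y P T ℓ)) := by
  have hTm := hT.measurable
  have hR : remote T Y X ≤ mΩ := remote_le hY hX hTm hTinv
  have hvi := integrable_infLoss (P := P) hR hY hTm hTinv hℓ hΛ hℓΛ
  have havg := tendsto_avg_iterate hT hvi
  rw [show ∫ ω, infLoss Y (remote T Y X) P T ℓ ω ∂P = Lstar Y P T ℓ from h3.symm] at havg
  have hnull {w : ℕ → Ω → U} (hw : ∀ k, w k ∈ decisions U T Y 0) :=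
    tendsto_avg_of_avgBound fun ε hε =>
      avgBound_loss_sub_condExp_remote hT hTinv hY hX hℓ hΛ hℓΛ h1 h2 h2' hw (ε := ε) hε
  obtain ⟨w, hw, hwL⟩ := exists_integral_loss_le_Lstar_add (P := P) hY hTm hTinv hℓ hΛ hℓΛ
  obtain ⟨v, hv, hvw⟩ := exists_slow_decisions hw
  have hai : ∀ n, Integrable (fun ω => P[loss ℓ T 0 (w n) | remote T Y X] ω -
      infLoss Y (remote T Y X) P T ℓ ω) P := fun n => integrable_condExp.sub hvi
  have hab : ∀ n, ∫ ω, |P[loss ℓ T 0 (w n) | remote T Y X] ω -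
      infLoss Y (remote T Y X) P T ℓ ω| ∂P ≤ (1 / 2) ^ n := fun n => by
    have h4 : ∫ ω, |P[loss ℓ T 0 (w n) | remote T Y X] ω - infLoss Y (remote T Y X) P T ℓ ω| ∂P =
        ∫ ω, (P[loss ℓ T 0 (w n) | remote T Y X] ω - infLoss Y (remote T Y X) P T ℓ ω) ∂P := by
      refine integral_congr_ae ?_
      filter_upwards [infLoss_le_condExp hR hY hTm hTinv hℓ hΛ hℓΛ (hw n)] with ω hω
      exact abs_of_nonneg (sub_nonneg.2 hω)
    -- Condition 3 enters here: the `L¹` error is exactly the expected loss of `w n` minus `L⋆`.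
    rw [h4, integral_sub integrable_condExp hvi, integral_condExp hR,
      show ∫ ω, infLoss Y (remote T Y X) P T ℓ ω ∂P = Lstar Y P T ℓ from h3.symm]
    linarith [hwL n]
  have hvavg := tendsto_avg_of_avgBound (P := P)
    (a := fun k ω => P[loss ℓ T 0 (v k) | remote T Y X] (T^[k] ω) -
      infLoss Y (remote T Y X) P T ℓ (T^[k] ω)) fun ε hε => by
    obtain ⟨N, d, hd, hdε, hdN⟩ := exists_dominating_tail hai
      (summable_geometric_of_lt_one (by norm_num : (0 : ℝ) ≤ 1 / 2) (by norm_num)) hab hε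
    refine avgBound_of_eventually_le (f := fun k ω => P[loss ℓ T 0 (v k) | remote T Y X] ω -
      infLoss Y (remote T Y X) P T ℓ ω) hT hd ?_ hdε
    filter_upwards [hvw N] with k ⟨n, hn, hk⟩
    rw [hk]
    exact hdN n hn
  have hlim : ∀ᵐ ω ∂P, Tendsto (fun N : ℕ => avgLoss ℓ T
      (fun k ω => v k ((T ^ (k : ℤ) : Equiv.Perm Ω) ω)) N ω) atTop (𝓝 (Lstar Y P T ℓ)) := by
    filter_upwards [havg, hvavg, hnull fun k => mem_decisions_of_measurable (hv k)]
      with ω h4 h5 h6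
    have h7 := (h6.add h5).add h4
    simp only [zero_add] at h7
    refine h7.congr fun N => ?_
    simp only [avgLoss, loss_comp_iterate, ← mul_add, ← Finset.sum_add_distrib]
    congr 1
    exact Finset.sum_congr rfl fun k _ => by ring
  refine ⟨_, ⟨admissible_of_measurable hv, fun u hu => ?_⟩, hlim⟩
  classical
  obtain ⟨x⟩ := ‹Nonempty U›
  -- Admissibility says nothing about `u 0`, so a constant takes its place; the averages start at `k
  -- = 1`.
  set z : ℕ → Ω → U := fun k => if 1 ≤ k then
    (fun ω => u k ((T ^ (-(k : ℤ)) : Equiv.Perm Ω) ω)) else fun _ => x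
  have hz : ∀ k, z k ∈ decisions U T Y 0 := fun k => by
    simp only [z]
    split_ifs with hk
    · exact hu.shift_mem_decisions hk
    · exact const_mem_decisions x
  have hinf : ∀ᵐ ω ∂P, ∀ k : ℕ, infLoss Y (remote T Y X) P T ℓ (T^[k] ω) ≤
      P[loss ℓ T 0 (z k) | remote T Y X] (T^[k] ω) := ae_all_iff.2 fun k =>
    (hT.toMeasurePreserving.iterate k).quasiMeasurePreserving.ae
      (infLoss_le_condExp hR hY hTm hTinv hℓ hΛ hℓΛ (hz k))
  filter_upwards [hlim, havg, hinf, hnull hz] with ω h4 h5 h6 h7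
  -- Replacing conditional losses by `infLoss` bounds the loss difference from below by this
  -- sequence, whose limit is `0 + L⋆ - L⋆`.
  have h8 := (h7.add h5).sub h4
  simp only [zero_add, sub_self] at h8
  have h9 := (continuous_coe_real_ereal.tendsto _).comp h8
  rw [← EReal.coe_zero, ← h9.liminf_eq]
  refine liminf_le_liminf (Eventually.of_forall fun N => EReal.coe_le_coe_iff.2 ?_)
  refine sub_le_sub_right ?_ _
  rw [← mul_add, ← Finset.sum_add_distrib, avgLoss]
  refine mul_le_mul_of_nonneg_left (Finset.sum_le_sum fun k hk => ?_) (by positivity)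
  have hzk : loss ℓ T k (u k) ω = loss ℓ T 0 (z k) (T^[k] ω) := by
    rw [loss_eq_comp]
    simp only [z, if_pos (Finset.mem_Icc.1 hk).1]
  rw [hzk]
  linarith [h6 k]
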